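/- Let $P$ be a nontrivial partial combinatory algebra (more than one element), with pairing operator $\mathbf p$, Church numerals $0,1$ and a standard coding $\langle n_1,\dots,n_k\rangle\in P$ of finite sequences of elements of $P$. For $A\subseteq P$ let $!A$ be the set of codes of finite sequences of elements of $A$, preordered by $m\preceq n$ iff every component of $m$ is a component of $n$. Let $\Sigma$ be the set of pairs $(A_0,A_1)$ with $A_1\subseteq P$ and $A_0\subseteq\, !A_1$ upwards closed in $!A_1$. For a set $I$ and $\varphi,\psi:I\to\Sigma$ write $\varphi\vdash\psi$ if there is $r\in P$ such that for all $i\in I$ and $n\in P$: if $n\in\,!\varphi(i)_1$ then $r\cdot n$ is defined and lies in $!\psi(i)_1$, and if $n\in\varphi(i)_0$ then $r\cdot n\in\psi(i)_0$. Conjunction and existential quantification in $\Sigma$ are given as follows. $(A\wedge B)_1=\{\mathbf p0a: a\in A_1\}\cup\{\mathbf p1b: b\in B_1\}$, and $(A\wedge B)_0$ consists of the codes of those sequences over this set whose left part (the sequence of the $a$'s) has its code in $A_0$ and whose right part (the sequence of the $b$'s) has its code in $B_0$. $(\exists_j\varphi_j)_1=\bigcup_j\,!(\varphi_j)_1$,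 and $(\exists_j\varphi_j)_0$ is the upward closure in $!(\exists_j\varphi_j)_1$ of $\{\langle n\rangle: \exists j,\ n\in(\varphi_j)_0\}$. The Herbrand topos $\mathbf{HT}[P]$ is the topos associated with this tripos. Its objects are pairs $(X,=)$ of a set $X$ and a map $[\![-=-]\!]:X\times X\to\Sigma$ that is symmetric and transitive with respect to $\vdash$. Its morphisms $(X,=)\to(Y,=)$ are strict, extensional, single-valued and total relations $F:X\times Y\to\Sigma$ modulo $F\dashv\vdash G$, the composite of $F$ and $G$ being $\exists y\,(F(x,y)\wedge G(y,z))$. A Herbrand assembly is a triple $(A,\mathcal A,\alpha)$ of a set $A$, a subset $\mathcal A\subseteq P$ and a function $\alpha$ assigning to every $a\in A$ an inhabited subset $\alpha(a)\subseteq\,!\mathcal A$ that is upwards closed in $!\mathcal A$. It is regarded as the object of $\mathbf{HT}[P]$ on $A$ with $[\![a=a']\!]=(\alpha(a),\mathcal A)$ if $a=a'$ and $(\emptyset,\mathcal A)$ otherwise. For a set $Z$ let $\nabla Z$ be the Herbrand assembly $(Z,P,z\mapsto\,!P)$. For an object $(X,=)$ let $X_0=\{x\in X:[\![x=x]\!]_0\neq\emptyset\}$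 and $\Gamma(X,=)=X_0/{\sim}$, where $x\sim x'$ iff $[\![x=x']\!]_0\ne\emptyset$. Then $\Gamma$ is left adjoint to $\nabla:\mathbf{Sets}\to\mathbf{HT}[P]$, and its unit $\eta_{(X,=)}:(X,=)\to\nabla\Gamma(X,=)$ is represented by $H(x,c)=[\![x=x]\!]$ if $x\in c$, and $H(x,c)=(\emptyset,[\![x=x]\!]_1)$ otherwise. An object $X$ is $\neg\neg$-separated if any two morphisms $f,g:B\to X$ that agree on a subobject $A\hookrightarrow B$ which is $\neg\neg$-dense (i.e. $\neg\neg A=\top$ among the subobjects of $B$) are equal. **Proposition.** For every object $(X,=)$ of $\mathbf{HT}[P]$ the following are equivalent: 1. $\eta_{(X,=)}:(X,=)\to\nabla\Gamma(X,=)$ is a monomorphism; 2. $(X,=)$ is $\neg\neg$-separated; 3. $(X,=)$ is isomorphic in $\mathbf{HT}[P]$ to a Herbrand assembly. -/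

import Mathlib

open CategoryTheory

universe u

/-- Partial combinatory algebras: a set with a partial application and combinators `k`, `s` with
`k x y = x`, `s x y` defined and `s x y z ≃ x z (y z)` (Kleene equality). -/
class PCA (P : Type u) where
  app : P → P → Part P
  k : P
  s : P
  k_spec : ∀ x y, ((app k x).bind fun f => app f y) = Part.some x
  s_dom : ∀ x y, ((app s x).bind fun f => app f y).Dom
  s_spec : ∀ x y z, (((app s x).bind fun f => app f y).bind fun f => app f z) =
    (app x z).bind fun f => (app y z).bind fun g => app f g

namespace PCA

section Combinators

variable {P : Type u} [PCA P]

theorem k_dom (x : P) : (app k x).Dom := by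
  have h : ((app k x).bind fun f => app f x).Dom := by rw [k_spec]; trivial
  exact h.1

/-- The element `k x`, that is `λ y. x`. -/
def kk (x : P) : P := (app k x).get (k_dom x)

/-- The element `s x y`, that is `λ z. x z (y z)`. -/
def ss (x y : P) : P := ((app s x).bind fun f => app f y).get (s_dom x y)

/-- The identity combinator `s k k`. -/
def ident : P := ss k k

/-- The Church numeral `0 = λ f x. x`. -/
def zero : P := kk ident

/-- The Church numeral `1 = λ f x. f x`. -/
def one : P := ss (ss (kk s) k) (kk ident)

/-- The pairing `p a b = λ z. z a b`. -/
def pair (a b : P) : P := ss (ss ident (kk a)) (kk b)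

/-- Codes of finite sequences: `<> = p 0 0` and `<a, a₁, …, aₙ> = p 1 (p a <a₁, …, aₙ>)`. -/
def code : List P → P
  | [] => pair zero zero
  | a :: l => pair one (pair a (code l))

theorem app_k (x : P) : app k x = Part.some (kk x) := (Part.some_get (k_dom x)).symm

theorem app_kk (x y : P) : app (kk x) y = Part.some x := by
  simpa [app_k] using k_spec x y

theorem app_s (x y : P) : ((app s x).bind fun f => app f y) = Part.some (ss x y) :=
  (Part.some_get (s_dom x y)).symm

theorem app_ss (x y z : P) :
    app (ss x y) z = (app x z).bind fun f => (app y z).bind fun g => app f g := by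
  simpa [app_s] using s_spec x y z

theorem app_ident (x : P) : app ident x = Part.some x := by
  simp [ident, app_ss, app_k, app_kk]

theorem app_zero (x : P) : app zero x = Part.some ident := by simp [zero, app_kk]

theorem app_one (f x : P) : ((app one f).bind fun g => app g x) = app f x := by
  have h : app one f = Part.some (ss (kk f) ident) := by
    simp [one, app_ss, app_kk, app_k, ← app_s]
  simp [h, app_ss, app_kk, app_ident]

theorem app_pair (a b z : P) : app (pair a b) z = (app z a).bind fun f => app f b := by
  simp [pair, app_ss, app_kk, app_ident]

theorem app_pair_k (a b : P) : app (pair a b) k = Part.some a := by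
  simp [app_pair, app_k, app_kk]

theorem app_pair_zero (a b : P) : app (pair a b) zero = Part.some b := by
  simp [app_pair, app_zero, app_ident]

theorem pair_inj {a b c d : P} (h : pair a b = pair c d) : a = c ∧ b = d := by
  constructor
  · have := app_pair_k a b
    rw [h, app_pair_k] at this
    exact (Part.some_inj.1 this).symm
  · have := app_pair_zero a b
    rw [h, app_pair_zero] at this
    exact (Part.some_inj.1 this).symm

theorem zero_ne_one [Nontrivial P] : (zero : P) ≠ one := by
  intro h
  obtain ⟨a, b, hab⟩ := exists_pair_ne P
  have h1 := app_one (kk a) b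
  rw [← h, app_zero, Part.bind_some, app_ident, app_kk] at h1
  exact hab (Part.some_inj.1 h1).symm

theorem code_inj [Nontrivial P] : ∀ {l l' : List P}, code l = code l' → l = l'
  | [], [], _ => rfl
  | [], _ :: _, h => absurd (pair_inj h).1 zero_ne_one
  | _ :: _, [], h => absurd (pair_inj h).1.symm zero_ne_one
  | a :: l, b :: l', h => by
    obtain ⟨h1, h2⟩ := pair_inj (pair_inj h).2
    rw [h1, code_inj h2]

/-! ### Combinatory completeness -/

/-- Terms over `P`, with de Bruijn variables. -/
inductive Tm (P : Type u) : Type u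
  | var : ℕ → Tm P
  | con : P → Tm P
  | ap : Tm P → Tm P → Tm P

/-- Extend an assignment of variables. -/
def ext (x : P) (ρ : ℕ → P) : ℕ → P
  | 0 => x
  | n + 1 => ρ n

/-- The value of a term. -/
def Tm.eval (ρ : ℕ → P) : Tm P → Part P
  | var n => Part.some (ρ n)
  | con a => Part.some a
  | ap t u => (t.eval ρ).bind fun f => (u.eval ρ).bind fun x => app f x

/-- Bracket abstraction. -/
def Tm.lam : Tm P → Tm P
  | var 0 => con ident
  | var (n + 1) => ap (con k) (var n)
  | con a => ap (con k) (con a)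
  | ap t u => ap (ap (con s) t.lam) u.lam

theorem Tm.lam_spec (ρ : ℕ → P) (t : Tm P) :
    ∃ v, t.lam.eval ρ = Part.some v ∧ ∀ x, app v x = t.eval (ext x ρ) := by
  induction t with
  | var n =>
    cases n with
    | zero => exact ⟨ident, rfl, fun x => by simp [app_ident, eval, ext]⟩
    | succ n => exact ⟨kk (ρ n), by simp [lam, eval, app_k], fun x => by simp [app_kk, eval, ext]⟩
  | con a => exact ⟨kk a, by simp [lam, eval, app_k], fun x => by simp [app_kk, eval]⟩
  | ap t u iht ihu =>
    obtain ⟨v, hv, hv'⟩ := iht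
    obtain ⟨w, hw, hw'⟩ := ihu
    refine ⟨ss v w, by simp [lam, eval, hv, hw, ← app_s], fun x => ?_⟩
    simp [app_ss, hv', hw', eval]

/-- The value of an abstraction. -/
noncomputable def Tm.lamV (ρ : ℕ → P) (t : Tm P) : P := (t.lam_spec ρ).choose

theorem Tm.eval_lam (ρ : ℕ → P) (t : Tm P) : t.lam.eval ρ = Part.some (t.lamV ρ) :=
  (t.lam_spec ρ).choose_spec.1

theorem Tm.app_lamV (ρ : ℕ → P) (t : Tm P) (x : P) : app (t.lamV ρ) x = t.eval (ext x ρ) :=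
  (t.lam_spec ρ).choose_spec.2 x

/-- A partial function of one variable given by a term is represented. -/
theorem exists_rep (t : Tm P) : ∃ r, ∀ x, app r x = t.eval (ext x fun _ => k) :=
  ⟨t.lamV _, t.app_lamV _⟩

theorem exists_rep₂ (t : Tm P) : ∃ r, ∀ x y, ((app r x).bind fun f => app f y) =
    t.eval (ext y (ext x fun _ => k)) :=
  ⟨t.lam.lamV fun _ => k, fun x y => by simp [Tm.app_lamV, Tm.eval_lam]⟩

theorem exists_rep₃ (t : Tm P) : ∃ r, ∀ x, ∃ v, app r x = Part.some v ∧
    ∀ y z, ((app v y).bind fun f => app f z) = t.eval (ext z (ext y (ext x fun _ => k))) :=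
  ⟨t.lam.lam.lamV fun _ => k, fun x => ⟨t.lam.lamV (ext x fun _ => k), by
    simp [Tm.app_lamV, Tm.eval_lam], fun y z => by simp [Tm.app_lamV, Tm.eval_lam]⟩⟩

theorem exists_pairing : ∃ e : P, ∀ a b, ((app e a).bind fun f => app f b) = Part.some (pair a b) := by
  obtain ⟨e, he⟩ := exists_rep₂ (P := P)
    (.ap (.ap (.con s) (.ap (.ap (.con s) (.con ident)) (.ap (.con k) (.var 1))))
      (.ap (.con k) (.var 0)))
  refine ⟨e, fun a b => ?_⟩
  rw [he]
  simp [Tm.eval, ext, app_k, pair, ← app_s]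
  simp [app_s]

theorem exists_fix : ∃ z : P, ∀ f, ∃ v, app z f = Part.some v ∧
    ∀ x, app v x = (app f v).bind fun g => app g x := by
  obtain ⟨t, ht⟩ : ∃ t : P, ∀ x, ∃ w, app t x = Part.some w ∧ ∀ f, ∃ v, app w f = Part.some v ∧
      ∀ y, app v y = (((app x x).bind fun g => app g f).bind fun g => app f g).bind
        fun g => app g y := by
    let b : Tm P := .ap (.ap (.var 1) (.ap (.ap (.var 2) (.var 2)) (.var 1))) (.var 0)
    refine ⟨b.lam.lam.lamV fun _ => k, fun x => ⟨b.lam.lamV (ext x fun _ => k), ?_,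
      fun f => ⟨b.lamV (ext f (ext x fun _ => k)), ?_, fun y => ?_⟩⟩⟩
    · rw [Tm.app_lamV, Tm.eval_lam]
    · rw [Tm.app_lamV, Tm.eval_lam]
    · rw [Tm.app_lamV]
      simp [b, Tm.eval, ext]
  obtain ⟨w, hw, hw'⟩ := ht t
  refine ⟨w, fun f => ?_⟩
  obtain ⟨v, hv, hv'⟩ := hw' f
  exact ⟨v, hv, fun x => by rw [hv', hw]; simp [hv]⟩

/-- Recursion over codes of sequences. -/
theorem exists_fold : ∃ e : P, ∀ f z, ∃ v, ((app e f).bind fun g => app g z) = Part.some v ∧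
    app v (code []) = Part.some z ∧
    ∀ a l, app v (code (a :: l)) =
      (app f a).bind fun g => (app v (code l)).bind fun acc => app g acc := by
  obtain ⟨Z, hZ⟩ := exists_fix (P := P)
  -- variables inside: 0 = dummy, 1 = list, 2 = recursive call, 3 = start value, 4 = step
  let snd : Tm P → Tm P := fun t => .ap t (.con zero)
  let fst : Tm P → Tm P := fun t => .ap t (.con k)
  let A : Tm P := .ap (.ap (.var 4) (fst (snd (.var 1)))) (.ap (.var 2) (snd (snd (.var 1))))
  let B : Tm P := .var 3
  let body : Tm P := .ap (.ap (.ap (fst (.var 0)) (.ap (.con k) A.lam)) B.lam) (.var 0)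
  obtain ⟨e, he⟩ := exists_rep₂ (P := P) (.ap (.con Z) body.lam.lam)
  refine ⟨e, fun f z => ?_⟩
  obtain ⟨v, hv, hv'⟩ := hZ (body.lam.lamV (ext z (ext f fun _ => k)))
  have key : ∀ x, app v x = body.eval (ext x (ext v (ext z (ext f fun _ => k)))) := fun x => by
    rw [hv', Tm.app_lamV, Tm.eval_lam, Part.bind_some, Tm.app_lamV]
  refine ⟨v, ?_, ?_, fun a l => ?_⟩
  · rw [he]
    simp [Tm.eval, Tm.eval_lam, hv]
  · rw [key]
    simp [body, fst, Tm.eval, Tm.eval_lam, ext, code, app_pair_k, app_k, app_zero, app_ident,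
      Tm.app_lamV, B]
  · rw [key]
    have h := app_one (kk (A.lamV (ext (code (a :: l)) (ext v (ext z (ext f fun _ => k))))))
    simp only [body, fst, Tm.eval, Tm.eval_lam, ext, code, app_pair_k, app_k, Part.bind_some]
      at h ⊢
    rw [h, app_kk, Part.bind_some, Tm.app_lamV]
    simp [A, fst, snd, Tm.eval, ext, app_pair_k, app_pair_zero]

theorem exists_append : ∃ e : P, ∀ l l' : List P,
    ((app e (code l)).bind fun g => app g (code l')) = Part.some (code (l ++ l')) := by
  obtain ⟨F, hF⟩ := exists_fold (P := P)
  obtain ⟨p, hp⟩ := exists_pairing (P := P)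
  obtain ⟨c, hc⟩ := exists_rep₂ (P := P)
    (.ap (.ap (.con p) (.con one)) (.ap (.ap (.con p) (.var 1)) (.var 0)))
  obtain ⟨e, he⟩ := exists_rep₂ (P := P) (.ap (.ap (.ap (.con F) (.con c)) (.var 0)) (.var 1))
  refine ⟨e, fun l l' => ?_⟩
  obtain ⟨v, hv, h0, h1⟩ := hF c (code l')
  have hv2 : app v (code l) = Part.some (code (l ++ l')) := by
    induction l with
    | nil => exact h0
    | cons a l ih =>
      rw [h1, ih]
      simp only [Part.bind_some]
      rw [hc]
      simp only [Tm.eval, ext, Part.bind_some]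
      rw [hp]
      simp only [Part.bind_some]
      rw [hp]
      rfl
  rw [he]
  simp [Tm.eval, ext, hv, hv2]

/-- The elements `p 0 a` and `p 1 b`. -/
def tag : P ⊕ P → P
  | .inl a => pair zero a
  | .inr b => pair one b

/-- The left and right parts of a sequence of tagged elements. -/
def lefts (l : List (P ⊕ P)) : List P := l.filterMap Sum.getLeft?

def rights (l : List (P ⊕ P)) : List P := l.filterMap Sum.getRight?

theorem tag_inj [Nontrivial P] : Function.Injective (tag (P := P)) := by
  rintro (a | a) (b | b) h
  · rw [(pair_inj h).2]
  · exact absurd (pair_inj h).1 zero_ne_one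
  · exact absurd (pair_inj h).1.symm zero_ne_one
  · rw [(pair_inj h).2]

theorem code_tag_inj [Nontrivial P] {l l' : List (P ⊕ P)}
    (h : code (l.map tag) = code (l'.map tag)) : l = l' :=
  List.map_injective_iff.2 tag_inj (code_inj h)

theorem exists_maptag (t : P) : ∃ e : P, ∀ l : List P,
    app e (code l) = Part.some (code (l.map fun a => pair t a)) := by
  obtain ⟨F, hF⟩ := exists_fold (P := P)
  obtain ⟨p, hp⟩ := exists_pairing (P := P)
  obtain ⟨c, hc⟩ := exists_rep₂ (P := P)
    (.ap (.ap (.con p) (.con one)) (.ap (.ap (.con p) (.ap (.ap (.con p) (.con t)) (.var 1)))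
      (.var 0)))
  obtain ⟨v, hv, h0, h1⟩ := hF c (code [])
  refine ⟨v, fun l => ?_⟩
  induction l with
  | nil => exact h0
  | cons a l ih =>
    rw [h1, ih]
    simp only [Part.bind_some]
    rw [hc]
    simp only [Tm.eval, ext, Part.bind_some]
    rw [hp]
    simp only [Part.bind_some]
    rw [hp]
    simp only [Part.bind_some]
    rw [hp]
    rfl

/-- The exponential isomorphism, from pairs of sequences to sequences. -/
theorem exists_merge : ∃ e : P, ∀ l l' : List P,
    ((app e (code l)).bind fun g => app g (code l')) =
      Part.some (code ((l.map Sum.inl ++ l'.map Sum.inr).map tag)) := by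
  obtain ⟨i, hi⟩ := exists_maptag (zero : P)
  obtain ⟨j, hj⟩ := exists_maptag (one : P)
  obtain ⟨ap, hap⟩ := exists_append (P := P)
  obtain ⟨e, he⟩ := exists_rep₂ (P := P)
    (.ap (.ap (.con ap) (.ap (.con i) (.var 1))) (.ap (.con j) (.var 0)))
  refine ⟨e, fun l l' => ?_⟩
  rw [he]
  simp only [Tm.eval, ext, Part.bind_some, hi, hj]
  rw [hap]
  simp [Function.comp_def, tag]

theorem exists_cases : ∃ w : P, ∀ x, ∀ y z : P,
    ((app w (tag x)).bind fun g => (app g y).bind fun g => app g z) =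
      Part.some (match x with | .inl _ => y | .inr _ => z) := by
  obtain ⟨w, hw⟩ := exists_rep₃ (P := P)
    (.ap (.ap (.ap (.var 2) (.con k)) (.ap (.con k) (.var 0))) (.var 1))
  refine ⟨w, fun x y z => ?_⟩
  obtain ⟨v, hv, hv'⟩ := hw (tag x)
  rw [hv, Part.bind_some, hv']
  cases x with
  | inl a => simp [Tm.eval, ext, tag, app_pair_k, app_k, app_zero, app_ident]
  | inr a =>
    have := app_one (kk z) y
    simp [Tm.eval, ext, tag, app_pair_k, app_k, app_kk] at this ⊢
    rw [this]

/-- The exponential isomorphism, from sequences to pairs of sequences. -/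
theorem exists_split :
    ∃ el er : P, ∀ l : List (P ⊕ P), app el (code (l.map tag)) = Part.some (code (lefts l)) ∧
      app er (code (l.map tag)) = Part.some (code (rights l)) := by
  obtain ⟨w, hw⟩ := exists_cases (P := P)
  obtain ⟨F, hF⟩ := exists_fold (P := P)
  obtain ⟨p, hp⟩ := exists_pairing (P := P)
  let cons : Tm P := .ap (.ap (.con p) (.con one)) (.ap (.ap (.con p) (.ap (.var 1) (.con zero)))
      (.var 0))
  have hcons : ∀ (x : P ⊕ P) (l : List P), cons.eval (ext (code l) (ext (tag x) fun _ => k)) =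
      Part.some (code ((match x with | .inl a => a | .inr a => a) :: l)) := by
    rintro (a | a) l <;>
    · simp only [cons, Tm.eval, ext, Part.bind_some, tag, app_pair_zero]
      rw [hp]
      simp only [Part.bind_some]
      rw [hp]
      rfl
  obtain ⟨cl, hcl⟩ := exists_rep₂ (P := P) (.ap (.ap (.ap (.con w) (.var 1)) cons) (.var 0))
  obtain ⟨cr, hcr⟩ := exists_rep₂ (P := P) (.ap (.ap (.ap (.con w) (.var 1)) (.var 0)) cons)
  obtain ⟨vl, -, hl0, hl1⟩ := hF cl (code [])
  obtain ⟨vr, -, hr0, hr1⟩ := hF cr (code [])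
  refine ⟨vl, vr, fun l => ?_⟩
  induction l with
  | nil => exact ⟨hl0, hr0⟩
  | cons x l ih =>
    rw [List.map_cons, hl1, hr1, ih.1, ih.2]
    simp only [Part.bind_some]
    rw [hcl, hcr]
    have e1 := hcons x (lefts l)
    have e2 := hcons x (rights l)
    have w1 := hw x
    simp only [Tm.eval, e1, e2, Part.bind_some, Part.bind_assoc] at w1 ⊢
    simp only [ext]
    rw [w1, w1]
    cases x <;> exact ⟨rfl, rfl⟩

end Combinators

end PCA

namespace Herbrand

open PCA

variable {P : Type u} [PCA P]

set_option linter.unusedSectionVars false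

/-- `!A`, the set of codes of finite sequences of elements of `A`. -/
def bang (A : Set P) : Set P := {n | ∃ l : List P, (∀ a ∈ l, a ∈ A) ∧ code l = n}

/-- `m ≼ n`: every component of the sequence `m` is a component of the sequence `n`. -/
def Below (m n : P) : Prop := ∃ l l' : List P, code l = m ∧ code l' = n ∧ l ⊆ l'

/-- The upwards closure of `X` in `!A`. -/
def upClosure (A X : Set P) : Set P := {n | n ∈ bang A ∧ ∃ m ∈ X, Below m n}

theorem Below.trans [Nontrivial P] {a b c : P} (h : Below a b) (h' : Below b c) : Below a c := by
  obtain ⟨l, l', rfl, rfl, hl⟩ := h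
  obtain ⟨l₁, l₂, h₁, rfl, hl'⟩ := h'
  rw [code_inj h₁] at hl'
  exact ⟨l, l₂, rfl, rfl, fun _ hx => hl' (hl hx)⟩

theorem code_mem_bang [Nontrivial P] {A : Set P} {l : List P} :
    code l ∈ bang A ↔ ∀ a ∈ l, a ∈ A := by
  constructor
  · rintro ⟨l', h, h'⟩
    rwa [← code_inj h']
  · exact fun h => ⟨l, h, rfl⟩

/-- Truth values `(A₀, A₁)`: a set `A₁ = pot` and a subset `A₀ = act` of `!A₁` (the actual
realizers) that is upwards closed in `!A₁` (the set of potential realizers). -/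
structure Sig (P : Type u) [PCA P] where
  act : Set P
  pot : Set P
  act_sub : act ⊆ bang pot
  up : ∀ m ∈ act, ∀ n ∈ bang pot, Below m n → n ∈ act

theorem Sig.up' (A : Sig P) {l l' : List P} (h : code l ∈ A.act) (hl : l ⊆ l')
    (h' : ∀ a ∈ l', a ∈ A.pot) : code l' ∈ A.act :=
  A.up _ h _ ⟨l', h', rfl⟩ ⟨l, l', rfl, rfl, hl⟩

theorem mem_lefts {l : List (P ⊕ P)} {a : P} : a ∈ lefts l ↔ Sum.inl a ∈ l := by
  simp [lefts, List.mem_filterMap]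

theorem mem_rights {l : List (P ⊕ P)} {a : P} : a ∈ rights l ↔ Sum.inr a ∈ l := by
  simp [rights, List.mem_filterMap]

/-- `A & B = {p 0 a : a ∈ A} ∪ {p 1 b : b ∈ B}`. -/
def amp (A B : Set P) : Set P := (fun a => pair zero a) '' A ∪ (fun b => pair one b) '' B

theorem exists_of_mem_amp {A B : Set P} (l : List P) (h : ∀ c ∈ l, c ∈ amp A B) :
    ∃ s : List (P ⊕ P), l = s.map tag ∧ (∀ a ∈ lefts s, a ∈ A) ∧ ∀ b ∈ rights s, b ∈ B := by
  induction l with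
  | nil => exact ⟨[], rfl, by simp [lefts], by simp [rights]⟩
  | cons c l ih =>
    obtain ⟨s, rfl, hs, hs'⟩ := ih fun c hc => h c (List.mem_cons_of_mem _ hc)
    rcases h c List.mem_cons_self with ⟨a, ha, rfl⟩ | ⟨b, hb, rfl⟩
    · refine ⟨.inl a :: s, rfl, fun x hx => ?_, fun x hx => ?_⟩
      · rcases List.mem_cons.1 (mem_lefts.1 hx) with h | h
        · cases h; exact ha
        · exact hs _ (mem_lefts.2 h)
      · rcases List.mem_cons.1 (mem_rights.1 hx) with h | h
        · cases h
        · exact hs' _ (mem_rights.2 h)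
    · refine ⟨.inr b :: s, rfl, fun x hx => ?_, fun x hx => ?_⟩
      · rcases List.mem_cons.1 (mem_lefts.1 hx) with h | h
        · cases h
        · exact hs _ (mem_lefts.2 h)
      · rcases List.mem_cons.1 (mem_rights.1 hx) with h | h
        · cases h; exact hb
        · exact hs' _ (mem_rights.2 h)

theorem mem_amp_of {A B : Set P} (s : List (P ⊕ P)) (h : ∀ a ∈ lefts s, a ∈ A)
    (h' : ∀ b ∈ rights s, b ∈ B) : ∀ c ∈ s.map tag, c ∈ amp A B := by
  intro c hc
  obtain ⟨x | x, hx, rfl⟩ := List.mem_map.1 hc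
  · exact .inl ⟨x, h x (mem_lefts.2 hx), rfl⟩
  · exact .inr ⟨x, h' x (mem_rights.2 hx), rfl⟩

variable [Nontrivial P]

/-- Conjunction. A sequence over `A₁ & B₁` is an actual realizer when the corresponding pair of a
sequence over `A₁` and a sequence over `B₁` consists of actual realizers. -/
def Sig.and (A B : Sig P) : Sig P where
  act := {n | ∃ l : List (P ⊕ P), code (l.map tag) = n ∧ code (lefts l) ∈ A.act ∧
    code (rights l) ∈ B.act}
  pot := amp A.pot B.pot
  act_sub := by
    rintro _ ⟨l, rfl, h, h'⟩
    exact ⟨_, mem_amp_of l (code_mem_bang.1 (A.act_sub h)) (code_mem_bang.1 (B.act_sub h')), rfl⟩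
  up := by
    rintro _ ⟨l, rfl, h, h'⟩ _ ⟨l', hl', rfl⟩ ⟨l₁, l₂, e₁, e₂, hs⟩
    rw [code_inj e₁, code_inj e₂] at hs
    obtain ⟨s, rfl, h₁, h₂⟩ := exists_of_mem_amp l' hl'
    have hs' : l ⊆ s := fun x hx => by
      obtain ⟨y, hy, hxy⟩ := List.mem_map.1 (hs (List.mem_map_of_mem hx))
      rwa [← tag_inj hxy]
    exact ⟨s, rfl, A.up' h (fun x hx => mem_lefts.2 (hs' (mem_lefts.1 hx))) h₁,
      B.up' h' (fun x hx => mem_rights.2 (hs' (mem_rights.1 hx))) h₂⟩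

/-- Existential quantification. -/
def Sig.ex {J : Type*} (φ : J → Sig P) : Sig P where
  act := upClosure (⋃ j, bang (φ j).pot) {m | ∃ j, ∃ n ∈ (φ j).act, m = code [n]}
  pot := ⋃ j, bang (φ j).pot
  act_sub := fun _ h => h.1
  up := fun _ ⟨_, x, hx, hxm⟩ _ hn h => ⟨hn, x, hx, hxm.trans h⟩

/-- `(A₀, A₁)` if `p` holds, and `(∅, A₁)` otherwise. -/
def Sig.restrict (A : Sig P) (p : Prop) : Sig P where
  act := {n | p ∧ n ∈ A.act}
  pot := A.pot
  act_sub := fun _ h => A.act_sub h.2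
  up := fun m hm n hn h => ⟨hm.1, A.up m hm.2 n hn h⟩

/-- The preorder `φ ≤ ψ` on predicates. -/
def Entails {I : Type*} (φ ψ : I → Sig P) : Prop :=
  ∃ r : P, ∀ i : I, ∀ n : P,
    (n ∈ bang (φ i).pot → ∃ m ∈ app r n, m ∈ bang (ψ i).pot) ∧
    (n ∈ (φ i).act → ∃ m ∈ app r n, m ∈ (ψ i).act)

section Logic

variable {I J : Type*} {Γ φ ψ χ : I → Sig P}

theorem Entails.of_le (h₁ : ∀ i, (φ i).pot ⊆ (ψ i).pot) (h₀ : ∀ i, (φ i).act ⊆ (ψ i).act) :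
    Entails φ ψ := by
  refine ⟨ident, fun i n => ⟨fun hn => ⟨n, by simp [app_ident], ?_⟩,
    fun hn => ⟨n, by simp [app_ident], h₀ i hn⟩⟩⟩
  obtain ⟨l, hl, rfl⟩ := hn
  exact ⟨l, fun a ha => h₁ i (hl a ha), rfl⟩

theorem Entails.refl (φ : I → Sig P) : Entails φ φ :=
  .of_le (fun _ => subset_rfl) fun _ => subset_rfl

theorem Entails.trans (h : Entails φ ψ) (h' : Entails ψ χ) : Entails φ χ := by
  obtain ⟨r, hr⟩ := h
  obtain ⟨s, hs⟩ := h'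
  obtain ⟨t, ht⟩ := exists_rep (P := P) (.ap (.con s) (.ap (.con r) (.var 0)))
  refine ⟨t, fun i n => ?_⟩
  have e : app t n = (app r n).bind fun m => app s m := by simp [ht, Tm.eval, ext]
  rw [e]
  constructor
  · intro hn
    obtain ⟨m, hm, hm'⟩ := (hr i n).1 hn
    obtain ⟨m', hm₁, hm₂⟩ := (hs i m).1 hm'
    exact ⟨m', Part.mem_bind hm hm₁, hm₂⟩
  · intro hn
    obtain ⟨m, hm, hm'⟩ := (hr i n).2 hn
    obtain ⟨m', hm₁, hm₂⟩ := (hs i m).2 hm'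
    exact ⟨m', Part.mem_bind hm hm₁, hm₂⟩

theorem Entails.reindex (h : Entails φ ψ) (f : J → I) :
    Entails (fun j => φ (f j)) (fun j => ψ (f j)) :=
  let ⟨r, hr⟩ := h
  ⟨r, fun j => hr (f j)⟩

/-- The constant realizer `<>`. -/
theorem Entails.const (h : ∀ i, (φ i).act.Nonempty → code [] ∈ (ψ i).act) : Entails φ ψ :=
  ⟨kk (code []), fun i n => ⟨fun _ => ⟨_, by rw [app_kk]; exact Part.mem_some _, [], by simp, rfl⟩,
    fun hn => ⟨_, by rw [app_kk]; exact Part.mem_some _, h i ⟨n, hn⟩⟩⟩⟩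

theorem Entails.of_empty (h : ∀ i, ¬ (φ i).act.Nonempty) : Entails φ ψ :=
  .const fun i hi => (h i hi).elim

theorem Entails.restrict {p : I → Prop} (h : Entails φ ψ) (hp : ∀ i, (φ i).act.Nonempty → p i) :
    Entails φ (fun i => (ψ i).restrict (p i)) :=
  let ⟨r, hr⟩ := h
  ⟨r, fun i n => ⟨(hr i n).1, fun hn =>
    let ⟨m, hm, hm'⟩ := (hr i n).2 hn
    ⟨m, hm, hp i ⟨n, hn⟩, hm'⟩⟩⟩

theorem Entails.nonempty (h : Entails φ ψ) (i : I) (hi : (φ i).act.Nonempty) :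
    (ψ i).act.Nonempty :=
  let ⟨_, hr⟩ := h
  let ⟨n, hn⟩ := hi
  let ⟨m, _, hm⟩ := (hr i n).2 hn
  ⟨m, hm⟩

theorem lefts_merge (l l' : List P) : lefts (l.map Sum.inl ++ l'.map Sum.inr) = l := by
  simp [lefts, List.filterMap_append, List.filterMap_map, Function.comp_def]

theorem rights_merge (l l' : List P) : rights (l.map Sum.inl ++ l'.map Sum.inr) = l' := by
  simp [rights, List.filterMap_append, List.filterMap_map, Function.comp_def]

theorem merge_act {A B : Sig P} {l l' : List P} (h : code l ∈ A.act) (h' : code l' ∈ B.act) :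
    code ((l.map Sum.inl ++ l'.map Sum.inr).map tag) ∈ (A.and B).act :=
  ⟨_, rfl, by rwa [lefts_merge], by rwa [rights_merge]⟩

theorem merge_pot {A B : Sig P} {l l' : List P} (h : ∀ a ∈ l, a ∈ A.pot)
    (h' : ∀ a ∈ l', a ∈ B.pot) :
    code ((l.map Sum.inl ++ l'.map Sum.inr).map tag) ∈ bang (A.and B).pot :=
  ⟨_, mem_amp_of _ (by rwa [lefts_merge]) (by rwa [rights_merge]), rfl⟩

theorem Entails.and (h : Entails Γ φ) (h' : Entails Γ ψ) :
    Entails Γ (fun i => (φ i).and (ψ i)) := by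
  obtain ⟨r, hr⟩ := h
  obtain ⟨s, hs⟩ := h'
  obtain ⟨e, he⟩ := exists_merge (P := P)
  obtain ⟨t, ht⟩ := exists_rep (P := P)
    (.ap (.ap (.con e) (.ap (.con r) (.var 0))) (.ap (.con s) (.var 0)))
  have key : ∀ n l l', code l ∈ app r n → code l' ∈ app s n →
      code ((l.map Sum.inl ++ l'.map Sum.inr).map tag) ∈ app t n := by
    intro n l l' h h'
    have := he l l'
    rw [ht]
    simp only [Tm.eval, ext, Part.bind_some, Part.eq_some_iff.2 h, Part.eq_some_iff.2 h'] at this ⊢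
    rw [this]
    exact Part.mem_some _
  refine ⟨t, fun i n => ⟨fun hn => ?_, fun hn => ?_⟩⟩
  · obtain ⟨_, hm, l, hl, rfl⟩ := (hr i n).1 hn
    obtain ⟨_, hm', l', hl', rfl⟩ := (hs i n).1 hn
    exact ⟨_, key n l l' hm hm', merge_pot hl hl'⟩
  · obtain ⟨m, hm, ha⟩ := (hr i n).2 hn
    obtain ⟨m', hm', ha'⟩ := (hs i n).2 hn
    obtain ⟨l, hl, rfl⟩ := (φ i).act_sub ha
    obtain ⟨l', hl', rfl⟩ := (ψ i).act_sub ha'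
    exact ⟨_, key n l l' hm hm', merge_act ha ha'⟩

theorem Entails.left (h : Entails Γ (fun i => (φ i).and (ψ i))) : Entails Γ φ := by
  refine h.trans ?_
  obtain ⟨el, er, he⟩ := exists_split (P := P)
  refine ⟨el, fun i n => ⟨fun hn => ?_, fun hn => ?_⟩⟩
  · obtain ⟨l, hl, rfl⟩ := hn
    obtain ⟨s, rfl, hs, hs'⟩ := exists_of_mem_amp l hl
    exact ⟨_, by rw [(he s).1]; exact Part.mem_some _, _, hs, rfl⟩
  · obtain ⟨s, rfl, hs, hs'⟩ := hn
    exact ⟨_, by rw [(he s).1]; exact Part.mem_some _, hs⟩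

theorem Entails.right (h : Entails Γ (fun i => (φ i).and (ψ i))) : Entails Γ ψ := by
  refine h.trans ?_
  obtain ⟨el, er, he⟩ := exists_split (P := P)
  refine ⟨er, fun i n => ⟨fun hn => ?_, fun hn => ?_⟩⟩
  · obtain ⟨l, hl, rfl⟩ := hn
    obtain ⟨s, rfl, hs, hs'⟩ := exists_of_mem_amp l hl
    exact ⟨_, by rw [(he s).2]; exact Part.mem_some _, _, hs', rfl⟩
  · obtain ⟨s, rfl, hs, hs'⟩ := hn
    exact ⟨_, by rw [(he s).2]; exact Part.mem_some _, hs'⟩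

/-- The realizer `n ↦ <n>`. -/
theorem Entails.single {φ : I → Sig P} {ψ : I → J → Sig P}
    (h₁ : ∀ i, ∀ n ∈ bang (φ i).pot, ∃ j, n ∈ bang (ψ i j).pot)
    (h₀ : ∀ i, ∀ n ∈ (φ i).act, ∃ j, n ∈ (ψ i j).act) :
    Entails φ (fun i => Sig.ex (ψ i)) := by
  obtain ⟨p, hp⟩ := exists_pairing (P := P)
  obtain ⟨t, ht⟩ := exists_rep (P := P)
    (.ap (.ap (.con p) (.con one)) (.ap (.ap (.con p) (.var 0)) (.con (code []))))
  have ht' : ∀ n, code [n] ∈ app t n := fun n => by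
    rw [ht]
    simp only [Tm.eval, ext, Part.bind_some]
    rw [hp]
    simp only [Part.bind_some]
    rw [hp]
    exact Part.mem_some _
  have h₁' : ∀ i, ∀ n ∈ bang (φ i).pot, code [n] ∈ bang (Sig.ex (ψ i)).pot := fun i n hn =>
    ⟨[n], by simpa [Sig.ex] using h₁ i n hn, rfl⟩
  refine ⟨t, fun i n => ⟨fun hn => ⟨_, ht' n, h₁' i n hn⟩, fun hn => ⟨_, ht' n,
    h₁' i n ((φ i).act_sub hn), code [n], ?_, [n], [n], rfl, rfl, fun _ h => h⟩⟩⟩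
  obtain ⟨j, hj⟩ := h₀ i n hn
  exact ⟨j, n, hj, rfl⟩

theorem Entails.ex_mk {ψ : I → J → Sig P} (f : I → J) (h : Entails Γ (fun i => ψ i (f i))) :
    Entails Γ (fun i => Sig.ex (ψ i)) :=
  h.trans (.single (fun i _ hn => ⟨f i, hn⟩) fun i _ hn => ⟨f i, hn⟩)

theorem Entails.ex_elim {ψ : I → J → Sig P}
    (h : Entails (fun p : I × J => (ψ p.1 p.2).and (Γ p.1)) (fun p => χ p.1)) :
    Entails (fun i => (Sig.ex (ψ i)).and (Γ i)) χ := by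
  obtain ⟨r, hr⟩ := h
  obtain ⟨el, er, he⟩ := exists_split (P := P)
  obtain ⟨mg, hmg⟩ := exists_merge (P := P)
  obtain ⟨ap, hap⟩ := exists_append (P := P)
  obtain ⟨F, hF⟩ := exists_fold (P := P)
  obtain ⟨T, hT⟩ := exists_rep₃ (P := P)
    (.ap (.ap (.con ap) (.ap (.con r) (.ap (.ap (.con mg) (.var 1)) (.var 2)))) (.var 0))
  obtain ⟨t, ht⟩ := exists_rep (P := P)
    (.ap (.ap (.ap (.con F) (.ap (.con T) (.ap (.con er) (.var 0)))) (.con (code [])))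
      (.ap (.con el) (.var 0)))
  have key : ∀ i (s : List (P ⊕ P)), (∀ a ∈ lefts s, a ∈ ⋃ j, bang (ψ i j).pot) →
      (∀ b ∈ rights s, b ∈ (Γ i).pot) → ∃ l, code l ∈ app t (code (s.map tag)) ∧
        (∀ x ∈ l, x ∈ (χ i).pot) ∧ ∀ a ∈ lefts s, ∀ j, a ∈ (ψ i j).act →
          code (rights s) ∈ (Γ i).act → code l ∈ (χ i).act := by
    intro i s
    obtain ⟨f, hf, hf'⟩ := hT (code (rights s))
    obtain ⟨v, hv, hv0, hv1⟩ := hF f (code [])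
    have e : app t (code (s.map tag)) = app v (code (lefts s)) := by
      rw [ht]
      simp only [Tm.eval, ext, Part.bind_some, (he s).1, (he s).2, hf]
      rw [hv, Part.bind_some]
    rw [e]
    generalize rights s = c at *
    generalize lefts s = ls
    intro hls hc
    induction ls with
    | nil => exact ⟨[], by rw [hv0]; exact Part.mem_some _, by simp, by simp⟩
    | cons a ls ih =>
      obtain ⟨l, hl, hl₁, hl₀⟩ := ih fun a ha => hls a (List.mem_cons_of_mem _ ha)
      obtain ⟨j, la, hla, rfl⟩ := Set.mem_iUnion.1 (hls _ List.mem_cons_self)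
      have hm : ∀ j, (∀ a ∈ la, a ∈ (ψ i j).pot) → ∃ l', code l' ∈
          app r (code ((la.map Sum.inl ++ c.map Sum.inr).map tag)) ∧
          (∀ x ∈ l', x ∈ (χ i).pot) := by
        intro j hj
        obtain ⟨_, h, l', hl', rfl⟩ := (hr (i, j) _).1 (merge_pot (A := ψ i j) hj hc)
        exact ⟨l', h, hl'⟩
      obtain ⟨l', h', hl'⟩ := hm j hla
      refine ⟨l' ++ l, ?_, ?_, ?_⟩
      · rw [hv1, Part.eq_some_iff.2 hl]
        simp only [Part.bind_some]
        rw [hf']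
        have h1 := hmg la c
        have h2 := hap l' l
        simp only [Tm.eval, ext, Part.bind_some, Part.bind_assoc] at h1 h2 ⊢
        rw [← Part.bind_assoc, h1, Part.bind_some, Part.eq_some_iff.2 h', Part.bind_some, h2]
        exact Part.mem_some _
      · intro x hx
        rcases List.mem_append.1 hx with hx | hx
        exacts [hl' x hx, hl₁ x hx]
      · intro a ha j' hj' hΓ
        have hpot : ∀ x ∈ l' ++ l, x ∈ (χ i).pot := fun x hx => by
          rcases List.mem_append.1 hx with hx | hx
          exacts [hl' x hx, hl₁ x hx]
        rcases List.mem_cons.1 ha with rfl | ha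
        · obtain ⟨m, hm₁, hm₂⟩ := (hr (i, j') _).2 (merge_act hj' hΓ)
          rw [Part.mem_unique hm₁ h'] at hm₂
          exact (χ i).up' hm₂ (fun x hx => List.mem_append_left _ hx) hpot
        · exact (χ i).up' (hl₀ a ha j' hj' hΓ) (fun x hx => List.mem_append_right _ hx) hpot
  refine ⟨t, fun i n => ⟨fun hn => ?_, fun hn => ?_⟩⟩
  · obtain ⟨l, hl, rfl⟩ := hn
    obtain ⟨s, rfl, hs, hs'⟩ := exists_of_mem_amp l hl
    obtain ⟨l, h₁, h₂, -⟩ := key i s hs hs'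
    exact ⟨_, h₁, l, h₂, rfl⟩
  · obtain ⟨s, rfl, hs, hs'⟩ := hn
    obtain ⟨l, h₁, -, h₂⟩ := key i s (code_mem_bang.1 ((Sig.ex (ψ i)).act_sub hs))
      (code_mem_bang.1 ((Γ i).act_sub hs'))
    obtain ⟨-, _, ⟨j, n, hn, rfl⟩, l₁, l₂, e₁, e₂, hsub⟩ := hs
    rw [code_inj e₁, code_inj e₂] at hsub
    exact ⟨_, h₁, h₂ n (hsub List.mem_cons_self) j hn hs'⟩

theorem Entails.ex_cases {ψ : I → J → Sig P} (h : Entails Γ (fun i => Sig.ex (ψ i)))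
    (h' : Entails (fun p : I × J => (ψ p.1 p.2).and (Γ p.1)) (fun p => χ p.1)) :
    Entails Γ χ :=
  (h.and (.refl Γ)).trans h'.ex_elim

end Logic

/-- The objects of the Herbrand topos: sets with a `Sig`-valued partial equivalence relation. -/
structure HT (P : Type u) [PCA P] [Nontrivial P] : Type (u + 1) where
  carrier : Type u
  eq : carrier → carrier → Sig P
  symm : Entails (fun p : carrier × carrier => eq p.1 p.2) (fun p => eq p.2 p.1)
  trans : Entails (fun p : carrier × carrier × carrier => (eq p.1 p.2.1).and (eq p.2.1 p.2.2))
    (fun p => eq p.1 p.2.2)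

/-- Functional relations: strict, relational (extensional), single-valued and total. -/
structure FunRel (X Y : HT P) : Type u where
  rel : X.carrier → Y.carrier → Sig P
  strict : Entails (fun p : X.carrier × Y.carrier => rel p.1 p.2)
    (fun p => (X.eq p.1 p.1).and (Y.eq p.2 p.2))
  extensional : Entails
    (fun p : (X.carrier × X.carrier) × (Y.carrier × Y.carrier) =>
      (rel p.1.1 p.2.1).and ((X.eq p.1.1 p.1.2).and (Y.eq p.2.1 p.2.2)))
    (fun p => rel p.1.2 p.2.2)
  single : Entails (fun p : X.carrier × Y.carrier × Y.carrier =>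
    (rel p.1 p.2.1).and (rel p.1 p.2.2)) (fun p => Y.eq p.2.1 p.2.2)
  total : Entails (fun x : X.carrier => X.eq x x) (fun x => Sig.ex fun y => rel x y)

section Rules

variable {I : Type u} {Γ : I → Sig P} {X Y Z W : HT P}

theorem HT.symm' (X : HT P) {x y : I → X.carrier} (h : Entails Γ fun i => X.eq (x i) (y i)) :
    Entails Γ fun i => X.eq (y i) (x i) :=
  h.trans (X.symm.reindex fun i => (x i, y i))

theorem HT.trans' (X : HT P) {x y z : I → X.carrier} (h : Entails Γ fun i => X.eq (x i) (y i))
    (h' : Entails Γ fun i => X.eq (y i) (z i)) : Entails Γ fun i => X.eq (x i) (z i) :=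
  (h.and h').trans (X.trans.reindex fun i => (x i, y i, z i))

namespace FunRel

variable (F : FunRel X Y) {x x' : I → X.carrier} {y y' : I → Y.carrier}

theorem left (h : Entails Γ fun i => F.rel (x i) (y i)) : Entails Γ fun i => X.eq (x i) (x i) :=
  (h.trans (F.strict.reindex fun i => (x i, y i))).left

theorem right (h : Entails Γ fun i => F.rel (x i) (y i)) : Entails Γ fun i => Y.eq (y i) (y i) :=
  (h.trans (F.strict.reindex fun i => (x i, y i))).right

theorem ext' (h : Entails Γ fun i => F.rel (x i) (y i)) (h₁ : Entails Γ fun i => X.eq (x i) (x' i))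
    (h₂ : Entails Γ fun i => Y.eq (y i) (y' i)) : Entails Γ fun i => F.rel (x' i) (y' i) :=
  (h.and (h₁.and h₂)).trans (F.extensional.reindex fun i => ((x i, x' i), (y i, y' i)))

theorem single' (h : Entails Γ fun i => F.rel (x i) (y i))
    (h' : Entails Γ fun i => F.rel (x i) (y' i)) : Entails Γ fun i => Y.eq (y i) (y' i) :=
  (h.and h').trans (F.single.reindex fun i => (x i, y i, y' i))

theorem total' (h : Entails Γ fun i => X.eq (x i) (x i)) :
    Entails Γ fun i => Sig.ex fun y => F.rel (x i) y :=
  h.trans (F.total.reindex x)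

/-- `F ≤ G` as predicates on `X × Y`. -/
def Le (F G : FunRel X Y) : Prop :=
  Entails (fun p : X.carrier × Y.carrier => F.rel p.1 p.2) (fun p => G.rel p.1 p.2)

theorem Le.rule {F G : FunRel X Y} (hl : F.Le G) (h : Entails Γ fun i => F.rel (x i) (y i)) :
    Entails Γ fun i => G.rel (x i) (y i) :=
  h.trans (hl.reindex fun i => (x i, y i))

theorem Le.refl (F : FunRel X Y) : F.Le F := Entails.refl _

theorem Le.trans {F G H : FunRel X Y} (h : F.Le G) (h' : G.Le H) : F.Le H := Entails.trans h h'

theorem Le.symm {F G : FunRel X Y} (h : F.Le G) : G.Le F := by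
  have h₀ : Entails (fun p : X.carrier × Y.carrier => G.rel p.1 p.2) _ := .refl _
  refine (F.total' (G.left h₀)).ex_cases ?_
  have h₁ := Entails.refl (fun q : (X.carrier × Y.carrier) × Y.carrier =>
    (F.rel q.1.1 q.2).and (G.rel q.1.1 q.1.2))
  exact F.ext' h₁.left (F.left h₁.left) (G.single' (h.rule h₁.left) h₁.right)

/-- The identity functional relation. -/
def id (X : HT P) : FunRel X X where
  rel := X.eq
  strict := by
    have h := Entails.refl (fun p : X.carrier × X.carrier => X.eq p.1 p.2)
    exact (X.trans' h (X.symm' h)).and (X.trans' (X.symm' h) h)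
  extensional := by
    have h := Entails.refl (fun p : (X.carrier × X.carrier) × (X.carrier × X.carrier) =>
      (X.eq p.1.1 p.2.1).and ((X.eq p.1.1 p.1.2).and (X.eq p.2.1 p.2.2)))
    exact X.trans' (X.symm' h.right.left) (X.trans' h.left h.right.right)
  single := by
    have h := Entails.refl (fun p : X.carrier × X.carrier × X.carrier =>
      (X.eq p.1 p.2.1).and (X.eq p.1 p.2.2))
    exact X.trans' (X.symm' h.left) h.right
  total := Entails.ex_mk (fun x => x) (.refl _)

/-- The composite `∃ y, F(x, y) ∧ G(y, z)`. -/
def comp (F : FunRel X Y) (G : FunRel Y Z) : FunRel X Z where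
  rel x z := Sig.ex fun y => (F.rel x y).and (G.rel y z)
  strict := by
    refine (Entails.refl _).ex_cases ?_
    have h := (Entails.refl (fun q : (X.carrier × Z.carrier) × Y.carrier =>
      ((F.rel q.1.1 q.2).and (G.rel q.2 q.1.2)).and
        (Sig.ex fun y => (F.rel q.1.1 y).and (G.rel y q.1.2)))).left
    exact (F.left h.left).and (G.right h.right)
  extensional := by
    refine (Entails.refl _).left.ex_cases ?_
    have h := Entails.refl
      (fun q : ((X.carrier × X.carrier) × (Z.carrier × Z.carrier)) × Y.carrier =>
        ((F.rel q.1.1.1 q.2).and (G.rel q.2 q.1.2.1)).and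
          ((Sig.ex fun y => (F.rel q.1.1.1 y).and (G.rel y q.1.2.1)).and
            ((X.eq q.1.1.1 q.1.1.2).and (Z.eq q.1.2.1 q.1.2.2))))
    exact Entails.ex_mk (fun q => q.2)
      ((F.ext' h.left.left h.right.right.left (F.right h.left.left)).and
        (G.ext' h.left.right (G.left h.left.right) h.right.right.right))
  single := by
    refine (Entails.refl _).left.ex_cases ?_
    refine (Entails.refl _).right.right.ex_cases ?_
    have h := Entails.refl
      (fun q : ((X.carrier × Z.carrier × Z.carrier) × Y.carrier) × Y.carrier =>
        ((F.rel q.1.1.1 q.2).and (G.rel q.2 q.1.1.2.2)).and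
          (((F.rel q.1.1.1 q.1.2).and (G.rel q.1.2 q.1.1.2.1)).and
            ((Sig.ex fun y => (F.rel q.1.1.1 y).and (G.rel y q.1.1.2.1)).and
              (Sig.ex fun y => (F.rel q.1.1.1 y).and (G.rel y q.1.1.2.2)))))
    have e := F.single' h.right.left.left h.left.left
    exact G.single' (G.ext' h.right.left.right e (G.right h.right.left.right)) h.left.right
  total := by
    refine (F.total' (x := fun x => x) (Entails.refl _)).ex_cases ?_
    have h := Entails.refl (fun q : X.carrier × Y.carrier =>
      (F.rel q.1 q.2).and (X.eq q.1 q.1))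
    refine (G.total' (F.right h.left)).ex_cases ?_
    have h := Entails.refl (fun q : (X.carrier × Y.carrier) × Z.carrier =>
      (G.rel q.1.2 q.2).and ((F.rel q.1.1 q.1.2).and (X.eq q.1.1 q.1.1)))
    exact Entails.ex_mk (fun q => q.2) (Entails.ex_mk (fun q => q.1.2) (h.right.left.and h.left))

theorem comp_le {F F' : FunRel X Y} {G G' : FunRel Y Z} (hF : F.Le F') (hG : G.Le G') :
    (F.comp G).Le (F'.comp G') := by
  refine (Entails.refl _).ex_cases ?_
  have h := (Entails.refl (fun q : (X.carrier × Z.carrier) × Y.carrier =>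
    ((F.rel q.1.1 q.2).and (G.rel q.2 q.1.2)).and ((F.comp G).rel q.1.1 q.1.2))).left
  exact Entails.ex_mk (fun q => q.2) ((hF.rule h.left).and (hG.rule h.right))

theorem id_comp_le (F : FunRel X Y) : ((id X).comp F).Le F := by
  refine (Entails.refl _).ex_cases ?_
  have h := (Entails.refl (fun q : (X.carrier × Y.carrier) × X.carrier =>
    ((X.eq q.1.1 q.2).and (F.rel q.2 q.1.2)).and (((id X).comp F).rel q.1.1 q.1.2))).left
  exact F.ext' h.right (X.symm' h.left) (F.right h.right)

theorem comp_id_le (F : FunRel X Y) : (F.comp (id Y)).Le F := by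
  refine (Entails.refl _).ex_cases ?_
  have h := (Entails.refl (fun q : (X.carrier × Y.carrier) × Y.carrier =>
    ((F.rel q.1.1 q.2).and (Y.eq q.2 q.1.2)).and ((F.comp (id Y)).rel q.1.1 q.1.2))).left
  exact F.ext' h.left (F.left h.left) h.right

theorem assoc_le (F : FunRel X Y) (G : FunRel Y Z) (H : FunRel Z W) :
    ((F.comp G).comp H).Le (F.comp (G.comp H)) := by
  refine (Entails.refl _).ex_cases ?_
  refine (Entails.refl _).left.left.ex_cases ?_
  have h := Entails.refl (fun q : ((X.carrier × W.carrier) × Z.carrier) × Y.carrier =>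
    ((F.rel q.1.1.1 q.2).and (G.rel q.2 q.1.2)).and
      ((((F.comp G).rel q.1.1.1 q.1.2).and (H.rel q.1.2 q.1.1.2)).and
        (((F.comp G).comp H).rel q.1.1.1 q.1.1.2)))
  exact Entails.ex_mk (fun q => q.2)
    (h.left.left.and (Entails.ex_mk (fun q => q.1.2) (h.left.right.and h.right.left.right)))

instance setoid (X Y : HT P) : Setoid (FunRel X Y) where
  r := Le
  iseqv := ⟨Le.refl, Le.symm, Le.trans⟩

end FunRel

end Rules

/-- The Herbrand topos: morphisms are functional relations up to `≤` in both directions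
(`FunRel.Le` is symmetric on functional relations). -/
instance : LargeCategory (HT P) where
  Hom X Y := Quotient (FunRel.setoid X Y)
  id X := ⟦FunRel.id X⟧
  comp f g := Quotient.map₂ FunRel.comp (fun _ _ h _ _ h' => FunRel.comp_le h h') f g
  id_comp f := by
    induction f using Quotient.inductionOn
    exact Quotient.sound (FunRel.id_comp_le _)
  comp_id f := by
    induction f using Quotient.inductionOn
    exact Quotient.sound (FunRel.comp_id_le _)
  assoc f g h := by
    induction f using Quotient.inductionOn
    induction g using Quotient.inductionOn
    induction h using Quotient.inductionOn
    exact Quotient.sound (FunRel.assoc_le _ _ _)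

/-- The morphism represented by a functional relation. -/
def FunRel.hom {X Y : HT P} (F : FunRel X Y) : X ⟶ Y := Quotient.mk (FunRel.setoid X Y) F

/-- Herbrand assemblies. -/
structure HAsm (P : Type u) [PCA P] : Type (u + 1) where
  carrier : Type u
  pot : Set P
  act : carrier → Set P
  act_sub : ∀ a, act a ⊆ bang pot
  act_up : ∀ a, ∀ m ∈ act a, ∀ n ∈ bang pot, Below m n → n ∈ act a
  act_nonempty : ∀ a, (act a).Nonempty

/-- The truth value `(α(a), 𝒜)`. -/
def HAsm.sig (A : HAsm P) (a : A.carrier) : Sig P := ⟨A.act a, A.pot, A.act_sub a, A.act_up a⟩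

/-- A Herbrand assembly as an object of the Herbrand topos: `⟦a = a'⟧` is `(α(a), 𝒜)` if `a = a'`
and `(∅, 𝒜)` otherwise. -/
def HAsm.toHT (A : HAsm P) : HT P where
  carrier := A.carrier
  eq a a' := (A.sig a).restrict (a = a')
  symm := .of_le (fun _ => subset_rfl) fun ⟨a, a'⟩ n ⟨h, hn⟩ => by
    cases h; exact ⟨rfl, hn⟩
  trans := by
    have h : Entails (fun p : A.carrier × A.carrier × A.carrier =>
        (A.sig p.1).restrict (p.1 = p.2.1)) (fun p => A.sig p.1) :=
      .of_le (fun _ => subset_rfl) fun p n hn => And.right hn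
    refine ((Entails.refl _).left.trans h).restrict ?_
    rintro ⟨a, b, c⟩ ⟨_, l, -, ⟨h, -⟩, ⟨h', -⟩⟩
    exact h.trans h'

/-- The Herbrand assembly `(X, P, x ↦ !P)`. -/
def nablaAsm (P : Type u) [PCA P] (X : Type u) : HAsm P where
  carrier := X
  pot := Set.univ
  act _ := bang Set.univ
  act_sub _ := subset_rfl
  act_up _ _ _ _ h _ := h
  act_nonempty _ := ⟨_, [], by simp, rfl⟩

/-- The object `∇X`. -/
def nabla (P : Type u) [PCA P] [Nontrivial P] (X : Type u) : HT P := (nablaAsm P X).toHT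

theorem nabla_eq_act {X : Type u} {x y : X} {n : P} :
    n ∈ ((nabla P X).eq x y).act ↔ x = y ∧ n ∈ bang (Set.univ : Set P) := Iff.rfl

theorem nil_mem_nabla {X : Type u} {x y : X} (h : x = y) :
    code [] ∈ ((nabla P X).eq x y).act := ⟨h, [], by simp, rfl⟩

/-- The points of `X` that actually exist. -/
def HT.Pt (X : HT P) : Type u := {x : X.carrier // (X.eq x x).act.Nonempty}

theorem HT.symm_ne (X : HT P) {x y : X.carrier} (h : (X.eq x y).act.Nonempty) :
    (X.eq y x).act.Nonempty := X.symm.nonempty (x, y) h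

theorem and_ne {A B : Sig P} (h : A.act.Nonempty) (h' : B.act.Nonempty) :
    (A.and B).act.Nonempty := by
  obtain ⟨_, h⟩ := h
  obtain ⟨_, h'⟩ := h'
  obtain ⟨l, -, rfl⟩ := A.act_sub h
  obtain ⟨l', -, rfl⟩ := B.act_sub h'
  exact ⟨_, merge_act h h'⟩

theorem ne_of_and {A B : Sig P} (h : (A.and B).act.Nonempty) :
    A.act.Nonempty ∧ B.act.Nonempty :=
  let ⟨_, _, _, h, h'⟩ := h
  ⟨⟨_, h⟩, ⟨_, h'⟩⟩

theorem HT.trans_ne (X : HT P) {x y z : X.carrier} (h : (X.eq x y).act.Nonempty)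
    (h' : (X.eq y z).act.Nonempty) : (X.eq x z).act.Nonempty :=
  X.trans.nonempty (x, y, z) (and_ne h h')

instance HT.ptSetoid (X : HT P) : Setoid X.Pt where
  r x y := (X.eq x.1 y.1).act.Nonempty
  iseqv := ⟨fun x => x.2, fun h => X.symm_ne h, fun h h' => X.trans_ne h h'⟩

/-- The set `ΓX = X₀/∼`. -/
def HT.Gamma (X : HT P) : Type u := Quotient X.ptSetoid

theorem ex_ne {J : Type*} {φ : J → Sig P} (h : (Sig.ex φ).act.Nonempty) :
    ∃ j, (φ j).act.Nonempty :=
  let ⟨_, _, _, ⟨j, n, hn, _⟩, _⟩ := h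
  ⟨j, n, hn⟩

/-- The functional relation from `X` to `∇Y` representing the transpose of `f : ΓX → Y`:
`F(x, y) = ⟦x = x⟧` if `x ∈ X₀` and `f [x] = y`, and `(∅, ⟦x = x⟧₁)` otherwise. -/
def HT.transposeRel (X : HT P) {Y : Type u} (f : X.Gamma → Y) : FunRel X (nabla P Y) where
  rel x y := (X.eq x x).restrict
    (∃ h : (X.eq x x).act.Nonempty, f (Quotient.mk X.ptSetoid ⟨x, h⟩) = y)
  strict := by
    refine Entails.and (.of_le (fun _ => subset_rfl) fun _ _ h => And.right h) (.const ?_)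
    rintro ⟨x, y⟩ -
    exact nil_mem_nabla rfl
  extensional := by
    have h₀ := (Entails.refl
      (fun p : (X.carrier × X.carrier) × (Y × Y) =>
        ((X.eq p.1.1 p.1.1).restrict (∃ h : (X.eq p.1.1 p.1.1).act.Nonempty,
          f (Quotient.mk X.ptSetoid ⟨p.1.1, h⟩) = p.2.1)).and
          ((X.eq p.1.1 p.1.2).and ((nabla P Y).eq p.2.1 p.2.2)))).right.left
    refine (X.trans' (X.symm' h₀) h₀).restrict ?_
    rintro ⟨⟨x, x'⟩, ⟨y, y'⟩⟩ h
    obtain ⟨⟨_, ⟨hx, hy⟩, -⟩, h'⟩ := ne_of_and h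
    obtain ⟨h₁, ⟨_, h₂, -⟩⟩ := ne_of_and h'
    have hx' := X.trans_ne (X.symm_ne h₁) h₁
    exact ⟨hx', (congrArg f (Quotient.sound (X.symm_ne h₁))).trans (hy.trans h₂)⟩
  single := by
    refine .const ?_
    rintro ⟨x, y, y'⟩ h
    obtain ⟨⟨_, ⟨hx, hy⟩, -⟩, ⟨_, ⟨hx', hy'⟩, -⟩⟩ := ne_of_and h
    exact nil_mem_nabla (hy.symm.trans hy')
  total := by
    by_cases h : Nonempty X.Gamma
    · obtain ⟨c₀⟩ := h
      refine Entails.single (fun x n hn => ⟨f c₀, hn⟩) fun x n hn =>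
        ⟨_, ⟨⟨n, hn⟩, rfl⟩, hn⟩
    · exact .of_empty fun x hx => h ⟨Quotient.mk X.ptSetoid ⟨x, hx⟩⟩

/-- The unit `η : X → ∇ΓX`, represented by `H(x, c) = ⟦x = x⟧` if `x ∈ c` and `(∅, ⟦x = x⟧₁)`
otherwise. -/
def HT.eta (X : HT P) : X ⟶ nabla P X.Gamma := (X.transposeRel fun c => c).hom

/-- The functional relation representing `∇f`. -/
def nablaRel {X Y : Type u} (f : X → Y) : FunRel (nabla P X) (nabla P Y) where
  rel x y := ((nablaAsm P X).sig x).restrict (f x = y)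
  strict := by
    refine Entails.and (.const ?_) (.const ?_) <;>
    · rintro ⟨x, y⟩ -
      exact nil_mem_nabla rfl
  extensional := by
    refine .const ?_
    rintro ⟨⟨x, x'⟩, ⟨y, y'⟩⟩ h
    obtain ⟨⟨_, h₁, -⟩, h'⟩ := ne_of_and h
    obtain ⟨⟨_, h₂, -⟩, ⟨_, h₃, -⟩⟩ := ne_of_and h'
    exact ⟨(congrArg f h₂).symm.trans (h₁.trans h₃), [], by simp, rfl⟩
  single := by
    refine .const ?_
    rintro ⟨x, y, y'⟩ h
    obtain ⟨⟨_, h₁, -⟩, ⟨_, h₂, -⟩⟩ := ne_of_and h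
    exact nil_mem_nabla (h₁.symm.trans h₂)
  total := Entails.single (fun x n hn => ⟨f x, hn⟩) fun x n hn => ⟨f x, rfl, hn.2⟩

/-- The functor `∇` from sets to the Herbrand topos. -/
def nablaFunctor (P : Type u) [PCA P] [Nontrivial P] : Type u ⥤ HT P where
  obj X := nabla P X
  map f := (nablaRel (P := P) fun x => f x).hom
  map_id X := Quotient.sound (FunRel.Le.refl (FunRel.id (nabla P X)))
  map_comp {X Y Z} f g := by
    refine (Quotient.sound (?_ : FunRel.Le _ _)).symm
    refine Entails.const ?_
    rintro ⟨x, z⟩ h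
    obtain ⟨y, hy⟩ := ex_ne h
    obtain ⟨⟨_, h₁, -⟩, ⟨_, h₂, -⟩⟩ := ne_of_and hy
    exact ⟨(congrArg g h₁).trans h₂, [], by simp, rfl⟩

/-- `η` is the universal arrow from `X` to `∇`; so it is the unit of the adjunction `Γ ⊣ ∇`. -/
theorem HT.eta_universal (X : HT P) {Y : Type u} (g : X ⟶ (nablaFunctor P).obj Y) :
    ∃! f : X.Gamma ⟶ Y, X.eta ≫ (nablaFunctor P).map f = g := by
  have key : ∀ f : X.Gamma ⟶ Y, X.eta ≫ (nablaFunctor P).map f =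
      (X.transposeRel fun c => f c).hom := fun f => by
    refine Quotient.sound (?_ : FunRel.Le _ _)
    refine Entails.restrict (ψ := fun p : X.carrier × Y => X.eq p.1 p.1) ?_ ?_
    · exact FunRel.left _ (Entails.refl _)
    · rintro ⟨x, y⟩ h
      obtain ⟨c, hc⟩ := ex_ne h
      obtain ⟨⟨_, ⟨hx, h₁⟩, -⟩, ⟨_, h₂, -⟩⟩ := ne_of_and hc
      exact ⟨hx, (congrArg f h₁).trans h₂⟩
  induction g using Quotient.inductionOn with | _ G => ?_
  have hG : ∀ x y, (G.rel x y).act.Nonempty → (X.eq x x).act.Nonempty := fun x y h =>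
    (G.left (Entails.refl fun p : X.carrier × Y => G.rel p.1 p.2)).nonempty (x, y) h
  have hs : ∀ x x' y y', (X.eq x x').act.Nonempty → (G.rel x y).act.Nonempty →
      (G.rel x' y').act.Nonempty → y = y' := fun x x' y y' h h₁ h₂ => by
    have h₃ : ((nabla P Y).eq y y).act.Nonempty := ⟨_, nil_mem_nabla rfl⟩
    have h₄ : (G.rel x' y).act.Nonempty :=
      G.extensional.nonempty ((x, x'), (y, y)) (and_ne h₁ (and_ne h h₃))
    obtain ⟨_, h₅, -⟩ := G.single.nonempty (x', y, y') (and_ne h₄ h₂)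
    exact h₅
  have ht : ∀ x : X.Pt, ∃ y, (G.rel x.1 y).act.Nonempty := fun x => ex_ne (G.total.nonempty x.1 x.2)
  choose f₀ hf₀ using ht
  let f : X.Gamma → Y := Quotient.lift f₀ fun x x' h => hs x.1 x'.1 _ _ h (hf₀ x) (hf₀ x')
  refine ⟨TypeCat.ofHom f, ?_, fun f' hf' => ?_⟩
  · refine (key _).trans (Quotient.sound (?_ : FunRel.Le _ _)).symm
    refine Entails.restrict (ψ := fun p : X.carrier × Y => X.eq p.1 p.1) ?_ ?_
    · exact FunRel.left _ (Entails.refl _)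
    · rintro ⟨x, y⟩ h
      exact ⟨hG x y h, hs x x _ _ (hG x y h) (hf₀ ⟨x, hG x y h⟩) h⟩
  · have hl : FunRel.Le (X.transposeRel fun c => f' c) G := Quotient.exact ((key f').symm.trans hf')
    ext c
    induction c using Quotient.inductionOn with | _ x => ?_
    have h₁ := hl.nonempty (x.1, f' (Quotient.mk X.ptSetoid x))
      (let ⟨n, hn⟩ := x.2; ⟨n, ⟨x.2, rfl⟩, hn⟩)
    exact hs x.1 x.1 _ _ x.2 h₁ (hf₀ x)

/-- `n` is the pseudocomplement `¬a` of `a` in a partially ordered set with bottom. -/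
def IsPseudocomplement {α : Type*} [PartialOrder α] (a n : α) : Prop :=
  ∀ b, b ≤ n ↔ ∀ c, c ≤ b → c ≤ a → IsBot c

/-- A monomorphism `m : A → B` is `¬¬`-dense if `¬¬A = ⊤` in the poset of subobjects of `B`. -/
def IsDoubleNegDense {C : Type*} [Category C] {A B : C} (m : A ⟶ B) [Mono m] : Prop :=
  ∃ n : Subobject B, IsPseudocomplement (Subobject.mk m) n ∧ IsPseudocomplement n ⊤

/-- `X` is `¬¬`-separated if two morphisms to `X` that agree on a `¬¬`-dense subobject of their
domain are equal. -/
def IsDoubleNegSeparated {C : Type*} [Category C] (X : C) : Prop :=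
  ∀ (A B : C) (m : A ⟶ B) [Mono m], IsDoubleNegDense m → ∀ f g : B ⟶ X, m ≫ f = m ≫ g → f = g

end Herbrand

/-!
A functional relation `F : X → Y` represents a monomorphism exactly when it is injective in the
internal logic, `∃ y, F(x, y) ∧ F(x', y) ⊢ x = x'`; necessity is seen on the object of pairs
`(x, x')` satisfying the left-hand side (`FunRel.mono_of_kernel_le`, `FunRel.kernel_le_of_mono`).
Call `x` a point of `X` if `⟦x = x⟧` has an actual realizer. A subobject is the bottom one exactly
when it has no points, whence a subobject is `¬¬`-dense exactly when it contains all points of the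
ambient object (`IsDoubleNegDense.exists_rel_nonempty`, `isDoubleNegDense_of_rel_nonempty`).

* If `η` is a monomorphism, `X` is isomorphic to the image of `η`. The truth value of `c ∈ ΓX` in
  the image is `∃ x, x ∈ c`, whose set of potential realizers does not depend on `c`: the image is a
  Herbrand assembly (`HT.etaImage`).
* A Herbrand assembly is separated: `⟦a = a'⟧` has the same potential realizers as `⟦a = a⟧`, and the
  same actual ones if `a = a'`, so that parallel morphisms to an assembly are equal once they agree
  on points (`HAsm.hom_ext`).
* If `X` is separated, consider the pairs `(x, x')` identified by `η`. Those with `x = x'` form a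
  subobject, on which the two projections to `X` agree. It contains all points, since points of `X`
  identified by `η` are equal by construction of `ΓX`; hence the projections are equal, that is, `η`
  is injective in the internal logic.
-/

namespace Herbrand

open PCA

variable {P : Type u} [PCA P] [Nontrivial P]

/-! ### Morphisms of the Herbrand topos -/

theorem Sig.ex_nonempty {J : Type*} {φ : J → Sig P} {j : J} (h : (φ j).act.Nonempty) :
    (Sig.ex φ).act.Nonempty := by
  obtain ⟨n, hn⟩ := h
  refine ⟨code [n], ⟨[n], ?_, rfl⟩, code [n], ⟨j, n, hn, rfl⟩, [n], [n], rfl, rfl, fun _ h => h⟩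
  simpa [Sig.ex] using ⟨j, (φ j).act_sub hn⟩

variable {X Y Z U : HT P}

theorem FunRel.hom_eq_iff {F G : FunRel X Y} : F.hom = G.hom ↔ F.Le G :=
  ⟨fun h => Quotient.exact h, fun h => Quotient.sound h⟩

theorem exists_rel (f : X ⟶ Y) : ∃ F : FunRel X Y, F.hom = f := Quotient.exists_rep f

theorem FunRel.left_nonempty (F : FunRel X Y) {x : X.carrier} {y : Y.carrier}
    (h : (F.rel x y).act.Nonempty) : (X.eq x x).act.Nonempty :=
  (ne_of_and (F.strict.nonempty (x, y) h)).1

theorem FunRel.right_nonempty (F : FunRel X Y) {x : X.carrier} {y : Y.carrier}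
    (h : (F.rel x y).act.Nonempty) : (Y.eq y y).act.Nonempty :=
  (ne_of_and (F.strict.nonempty (x, y) h)).2

theorem FunRel.total_nonempty (F : FunRel X Y) {x : X.carrier} (h : (X.eq x x).act.Nonempty) :
    ∃ y, (F.rel x y).act.Nonempty :=
  ex_ne (F.total.nonempty x h)

/-- The predicate `∃ y, F(x, y) ∧ F(x', y)` on `X × X`. -/
def FunRel.kernel (F : FunRel X Y) (p : X.carrier × X.carrier) : Sig P :=
  Sig.ex fun y => (F.rel p.1 y).and (F.rel p.2 y)

theorem FunRel.kernel_strict (F : FunRel X Y) :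
    Entails F.kernel fun p => (X.eq p.1 p.1).and (X.eq p.2 p.2) := by
  refine (Entails.refl F.kernel).ex_cases ?_
  have h := (Entails.refl fun q : (X.carrier × X.carrier) × Y.carrier =>
    ((F.rel q.1.1 q.2).and (F.rel q.1.2 q.2)).and (F.kernel q.1)).left
  exact (F.left h.left).and (F.left h.right)

/-- A functional relation that is injective in the internal logic represents a monomorphism. -/
theorem FunRel.mono_of_kernel_le (F : FunRel X Y)
    (hF : Entails F.kernel fun p => X.eq p.1 p.2) : Mono F.hom := by
  refine ⟨fun {Z} f g h => ?_⟩
  obtain ⟨f, rfl⟩ := exists_rel f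
  obtain ⟨g, rfl⟩ := exists_rel g
  have hl : (f.comp F).Le (g.comp F) := hom_eq_iff.1 h
  refine hom_eq_iff.2 (?_ : Entails _ _)
  refine (F.total' (f.right (Entails.refl fun p : Z.carrier × X.carrier =>
    f.rel p.1 p.2))).ex_cases ?_
  have h₁ := Entails.refl fun q : (Z.carrier × X.carrier) × Y.carrier =>
    (F.rel q.1.2 q.2).and (f.rel q.1.1 q.1.2)
  have h₂ : Entails _ fun q : (Z.carrier × X.carrier) × Y.carrier =>
      (g.comp F).rel q.1.1 q.2 :=
    hl.rule (Entails.ex_mk (fun q => q.1.2) (h₁.right.and h₁.left))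
  refine h₂.ex_cases ?_
  have h₃ := Entails.refl fun q : ((Z.carrier × X.carrier) × Y.carrier) × X.carrier =>
    ((g.rel q.1.1.1 q.2).and (F.rel q.2 q.1.2)).and
      ((F.rel q.1.1.2 q.1.2).and (f.rel q.1.1.1 q.1.1.2))
  have h₄ : Entails _ fun q : ((Z.carrier × X.carrier) × Y.carrier) × X.carrier =>
      X.eq q.2 q.1.1.2 :=
    Entails.trans (Entails.ex_mk (fun q => q.1.2) (h₃.left.right.and h₃.right.left))
      (hF.reindex fun q : ((Z.carrier × X.carrier) × Y.carrier) × X.carrier => (q.2, q.1.1.2))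
  exact g.ext' h₃.left.left (g.left h₃.left.left) h₄

/-- The functional relation `y = f u` given by a function that respects equality. -/
def FunRel.ofFun (f : U.carrier → X.carrier)
    (hf : Entails (fun p : U.carrier × U.carrier => U.eq p.1 p.2)
      fun p => X.eq (f p.1) (f p.2)) : FunRel U X where
  rel u x := (U.eq u u).and (X.eq (f u) x)
  strict := by
    have h := Entails.refl fun p : U.carrier × X.carrier => (U.eq p.1 p.1).and (X.eq (f p.1) p.2)
    exact h.left.and (X.trans' (X.symm' h.right) h.right)
  extensional := by
    have h := Entails.refl fun p : (U.carrier × U.carrier) × (X.carrier × X.carrier) =>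
      ((U.eq p.1.1 p.1.1).and (X.eq (f p.1.1) p.2.1)).and
        ((U.eq p.1.1 p.1.2).and (X.eq p.2.1 p.2.2))
    have h₁ := U.symm' h.right.left
    exact (U.trans' h₁ h.right.left).and (X.trans' (h₁.trans (hf.reindex
      fun p : (U.carrier × U.carrier) × (X.carrier × X.carrier) => (p.1.2, p.1.1)))
      (X.trans' h.left.right h.right.right))
  single := by
    have h := Entails.refl fun p : U.carrier × X.carrier × X.carrier =>
      ((U.eq p.1 p.1).and (X.eq (f p.1) p.2.1)).and ((U.eq p.1 p.1).and (X.eq (f p.1) p.2.2))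
    exact X.trans' (X.symm' h.left.right) h.right.right
  total := Entails.ex_mk f ((Entails.refl _).and (hf.reindex fun u => (u, u)))

section OfFun

variable {f : U.carrier → X.carrier} {hf : Entails (fun p : U.carrier × U.carrier => U.eq p.1 p.2)
      fun p => X.eq (f p.1) (f p.2)}

theorem FunRel.eq_of_ofFun_hom_eq {g : U.carrier → X.carrier}
    {hg : Entails (fun p : U.carrier × U.carrier => U.eq p.1 p.2) fun p => X.eq (g p.1) (g p.2)}
    (h : (ofFun f hf).hom = (ofFun g hg).hom) :
    Entails (fun u => U.eq u u) fun u => X.eq (f u) (g u) := by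
  have hl : (ofFun f hf).Le (ofFun g hg) := hom_eq_iff.1 h
  have h₁ : Entails (fun u => U.eq u u) fun u => (ofFun f hf).rel u (f u) :=
    (Entails.refl _).and (hf.reindex fun u => (u, u))
  exact X.symm' (hl.rule h₁).right

theorem FunRel.ofFun_comp_eq {g : U.carrier → Y.carrier}
    {hg : Entails (fun p : U.carrier × U.carrier => U.eq p.1 p.2) fun p => Y.eq (g p.1) (g p.2)}
    {F : FunRel X Z} {G : FunRel Y Z}
    (h : Entails (fun u => U.eq u u) fun u => Sig.ex fun z => (F.rel (f u) z).and (G.rel (g u) z)) :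
    (ofFun f hf).hom ≫ F.hom = (ofFun g hg).hom ≫ G.hom := by
  refine hom_eq_iff.2 (?_ : Entails _ _)
  refine (Entails.refl _).ex_cases ?_
  have h₁ := (Entails.refl fun q : (U.carrier × Z.carrier) × X.carrier =>
    (((U.eq q.1.1 q.1.1).and (X.eq (f q.1.1) q.2)).and (F.rel q.2 q.1.2)).and
      (((ofFun f hf).comp F).rel q.1.1 q.1.2)).left
  refine (h₁.left.left.trans (h.reindex
    fun q : (U.carrier × Z.carrier) × X.carrier => q.1.1)).ex_cases ?_
  have h₂ := Entails.refl fun q : ((U.carrier × Z.carrier) × X.carrier) × Z.carrier =>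
    ((F.rel (f q.1.1.1) q.2).and (G.rel (g q.1.1.1) q.2)).and
      ((((U.eq q.1.1.1 q.1.1.1).and (X.eq (f q.1.1.1) q.1.2)).and (F.rel q.1.2 q.1.1.2)).and
        (((ofFun f hf).comp F).rel q.1.1.1 q.1.1.2))
  have h₃ := h₂.right.left
  have h₄ := F.ext' h₂.left.left h₃.left.right (F.right h₂.left.left)
  exact Entails.ex_mk (fun q => g q.1.1.1)
    ((h₃.left.left.and (G.left h₂.left.right)).and
      (G.ext' h₂.left.right (G.left h₂.left.right) (F.single' h₄ h₃.right)))

end OfFun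

/-- The object of pairs of elements of `X` that satisfy the predicate `K`. Since `K` occurs on both
sides of the equality predicate, no extensionality of `K` is needed. -/
def HT.pairs (X : HT P) (K : X.carrier × X.carrier → Sig P) : HT P where
  carrier := X.carrier × X.carrier
  eq p q := ((K p).and (K q)).and ((X.eq p.1 q.1).and (X.eq p.2 q.2))
  symm := by
    have h := Entails.refl fun p : (X.carrier × X.carrier) × (X.carrier × X.carrier) =>
      ((K p.1).and (K p.2)).and ((X.eq p.1.1 p.2.1).and (X.eq p.1.2 p.2.2))
    exact (h.left.right.and h.left.left).and
      ((X.symm' h.right.left).and (X.symm' h.right.right))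
  trans := by
    have h := Entails.refl fun p : (X.carrier × X.carrier) × (X.carrier × X.carrier) ×
        (X.carrier × X.carrier) =>
      (((K p.1).and (K p.2.1)).and ((X.eq p.1.1 p.2.1.1).and (X.eq p.1.2 p.2.1.2))).and
        (((K p.2.1).and (K p.2.2)).and ((X.eq p.2.1.1 p.2.2.1).and (X.eq p.2.1.2 p.2.2.2)))
    exact (h.left.left.left.and h.right.left.right).and
      ((X.trans' h.left.right.left h.right.right.left).and
        (X.trans' h.left.right.right h.right.right.right))

section Pairs

variable (X) (K : X.carrier × X.carrier → Sig P)

/-- The first projection of the object of pairs satisfying `K`. -/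
def HT.pairsFst : FunRel (X.pairs K) X :=
  .ofFun Prod.fst (Entails.refl fun p : (X.carrier × X.carrier) × (X.carrier × X.carrier) =>
    ((K p.1).and (K p.2)).and ((X.eq p.1.1 p.2.1).and (X.eq p.1.2 p.2.2))).right.left

/-- The second projection of the object of pairs satisfying `K`. -/
def HT.pairsSnd : FunRel (X.pairs K) X :=
  .ofFun Prod.snd (Entails.refl fun p : (X.carrier × X.carrier) × (X.carrier × X.carrier) =>
    ((K p.1).and (K p.2)).and ((X.eq p.1.1 p.2.1).and (X.eq p.1.2 p.2.2))).right.right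

variable {X K}

/-- If the projections of the object of pairs satisfying `K` agree, then `K` entails equality. -/
theorem HT.entails_eq_of_pairs
    (hK : Entails K fun p => (X.eq p.1 p.1).and (X.eq p.2 p.2))
    (h : (X.pairsFst K).hom = (X.pairsSnd K).hom) : Entails K fun p => X.eq p.1 p.2 := by
  have h₁ : Entails K fun p => (X.pairs K).eq p p := ((Entails.refl K).and (.refl K)).and hK
  exact h₁.trans (FunRel.eq_of_ofFun_hom_eq h)

end Pairs

/-- A monomorphism is injective in the internal logic: its kernel pair is trivial. -/
theorem FunRel.kernel_le_of_mono (F : FunRel X Y) [h : Mono F.hom] :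
    Entails F.kernel fun p => X.eq p.1 p.2 := by
  refine HT.entails_eq_of_pairs F.kernel_strict ((cancel_mono F.hom).1 (ofFun_comp_eq ?_))
  exact (Entails.refl fun p : X.carrier × X.carrier => (X.pairs F.kernel).eq p p).left.left

/-- The opposite of an internally bijective functional relation. -/
def FunRel.op (F : FunRel X Y) (hF : Entails F.kernel fun p => X.eq p.1 p.2)
    (hs : Entails (fun y => Y.eq y y) fun y => Sig.ex fun x => F.rel x y) : FunRel Y X where
  rel y x := F.rel x y
  strict := by
    have h := Entails.refl fun p : Y.carrier × X.carrier => F.rel p.2 p.1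
    exact (F.right h).and (F.left h)
  extensional := by
    have h := Entails.refl fun p : (Y.carrier × Y.carrier) × (X.carrier × X.carrier) =>
      (F.rel p.2.1 p.1.1).and ((Y.eq p.1.1 p.1.2).and (X.eq p.2.1 p.2.2))
    exact F.ext' h.left h.right.right h.right.left
  single := by
    have h := Entails.refl fun p : Y.carrier × X.carrier × X.carrier =>
      (F.rel p.2.1 p.1).and (F.rel p.2.2 p.1)
    have h₁ : Entails _ fun p : Y.carrier × X.carrier × X.carrier => F.kernel p.2 :=
      Entails.ex_mk (fun p => p.1) h
    exact h₁.trans (hF.reindex fun p : Y.carrier × X.carrier × X.carrier => p.2)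
  total := hs

/-- An internally bijective functional relation represents an isomorphism. -/
def FunRel.isoOfBijective (F : FunRel X Y) (hF : Entails F.kernel fun p => X.eq p.1 p.2)
    (hs : Entails (fun y => Y.eq y y) fun y => Sig.ex fun x => F.rel x y) : X ≅ Y where
  hom := F.hom
  inv := (F.op hF hs).hom
  hom_inv_id := (hom_eq_iff (F := F.comp (F.op hF hs)) (G := .id X)).2 hF
  inv_hom_id := (hom_eq_iff (F := (F.op hF hs).comp F) (G := .id Y)).2 (by
    refine (Entails.refl fun p : Y.carrier × Y.carrier =>
      ((F.op hF hs).comp F).rel p.1 p.2).ex_cases ?_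
    have h := (Entails.refl fun q : (Y.carrier × Y.carrier) × X.carrier =>
      ((F.rel q.2 q.1.1).and (F.rel q.2 q.1.2)).and (((F.op hF hs).comp F).rel q.1.1 q.1.2)).left
    exact F.single' h.left h.right)

/-! ### Objects without points and one-point objects -/

theorem HT.isEmpty_pt_iff : IsEmpty X.Pt ↔ ∀ x, ¬ (X.eq x x).act.Nonempty :=
  ⟨fun h x hx => h.false ⟨x, hx⟩, fun h => ⟨fun x => h x.1 x.2⟩⟩

theorem HT.isEmpty_pt_of_hom (f : X ⟶ Y) (h : IsEmpty Y.Pt) : IsEmpty X.Pt := by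
  obtain ⟨F, rfl⟩ := exists_rel f
  refine ⟨fun x => ?_⟩
  obtain ⟨y, hy⟩ := F.total_nonempty x.2
  exact h.false ⟨y, F.right_nonempty hy⟩

/-- An object without points has a functional relation to every object: entailments whose premiss
has no actual realizers hold. -/
def FunRel.ofEmpty (hX : IsEmpty X.Pt) (Y : HT P) : FunRel X Y where
  rel x _ := X.eq x x
  strict := .of_empty fun p => HT.isEmpty_pt_iff.1 hX p.1
  extensional := .of_empty fun p hp => HT.isEmpty_pt_iff.1 hX p.1.1 (ne_of_and hp).1
  single := .of_empty fun p hp => HT.isEmpty_pt_iff.1 hX p.1 (ne_of_and hp).1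
  total := .of_empty fun x => HT.isEmpty_pt_iff.1 hX x

theorem HT.hom_ext_of_isEmpty (hX : IsEmpty X.Pt) (f g : X ⟶ Y) : f = g := by
  obtain ⟨F, rfl⟩ := exists_rel f
  obtain ⟨G, rfl⟩ := exists_rel g
  exact FunRel.hom_eq_iff.2
    (Entails.of_empty fun p hp => HT.isEmpty_pt_iff.1 hX p.1 (F.left_nonempty hp))

/-- The empty object. -/
def HT.empty (P : Type u) [PCA P] [Nontrivial P] : HT P where
  carrier := PEmpty
  eq x _ := x.elim
  symm := .of_empty fun p => p.1.elim
  trans := .of_empty fun p => p.1.elim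

theorem HT.isEmpty_empty : IsEmpty (HT.empty P).Pt := ⟨fun x => x.1.elim⟩

instance FunRel.mono_ofEmpty (hX : IsEmpty X.Pt) : Mono (ofEmpty hX Y).hom :=
  ⟨fun f _ _ => HT.hom_ext_of_isEmpty (HT.isEmpty_pt_of_hom f hX) _ _⟩

/-- The subterminal object given by a truth value. -/
def HT.single (T : Sig P) : HT P where
  carrier := PUnit
  eq _ _ := T
  symm := .refl _
  trans := (Entails.refl fun _ : PUnit × PUnit × PUnit => T.and T).left

/-- The element `x` of `X`, defined to the extent `T`. -/
def HT.point (T : Sig P) (x : X.carrier) (h : Entails (fun _ : PUnit.{u + 1} => T)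
    fun _ => X.eq x x) : FunRel (HT.single T) X :=
  .ofFun (fun _ => x) (h.reindex fun _ => PUnit.unit)

theorem HT.mono_of_single {T : Sig P} (f : HT.single T ⟶ X) : Mono f := by
  obtain ⟨F, rfl⟩ := exists_rel f
  exact F.mono_of_kernel_le F.kernel_strict.left

theorem HT.not_isEmpty_single {T : Sig P} (hT : T.act.Nonempty) : ¬ IsEmpty (HT.single T).Pt :=
  fun h => h.false ⟨PUnit.unit, hT⟩

/-! ### Double negation dense subobjects -/

theorem isBot_iff_isEmpty_pt (c : Subobject X) : IsBot c ↔ IsEmpty (c : HT P).Pt := by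
  refine ⟨fun h => ?_, fun h d => ?_⟩
  · exact HT.isEmpty_pt_of_hom
      (Subobject.ofLEMk c (FunRel.ofEmpty HT.isEmpty_empty X).hom (h _)) HT.isEmpty_empty
  · exact Subobject.le_of_comm (FunRel.ofEmpty h (d : HT P)).hom (HT.hom_ext_of_isEmpty h _ _)

theorem isBot_mk_iff_isEmpty_pt (f : X ⟶ Y) [Mono f] :
    IsBot (Subobject.mk f) ↔ IsEmpty X.Pt := by
  rw [isBot_iff_isEmpty_pt]
  exact ⟨HT.isEmpty_pt_of_hom (Subobject.underlyingIso f).inv,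
    HT.isEmpty_pt_of_hom (Subobject.underlyingIso f).hom⟩

/-- A `¬¬`-dense subobject contains all points: a point outside it would span a non-empty subobject
disjoint from it. -/
theorem IsDoubleNegDense.exists_rel_nonempty {M : FunRel X Y} [Mono M.hom]
    (hM : IsDoubleNegDense M.hom) {y : Y.carrier} (hy : (Y.eq y y).act.Nonempty) :
    ∃ x, (M.rel x y).act.Nonempty := by
  obtain ⟨n, h₁, h₂⟩ := hM
  have hn : IsBot n := (h₂ ⊤).1 le_rfl n le_top le_rfl
  by_contra hne
  let s := HT.point (Y.eq y y) y (.refl _)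
  have := HT.mono_of_single s.hom
  refine HT.not_isEmpty_single hy ((isBot_mk_iff_isEmpty_pt s.hom).1 (hn.mono ((h₁ _).2 ?_)))
  refine fun c hs hm => (isBot_iff_isEmpty_pt c).2 ⟨fun z => hne ?_⟩
  obtain ⟨v, hv⟩ := exists_rel (Subobject.ofLEMk c s.hom hs)
  obtain ⟨w, hw⟩ := exists_rel (Subobject.ofLEMk c M.hom hm)
  have h : v.hom ≫ s.hom = w.hom ≫ M.hom := by
    rw [hv, hw, Subobject.ofLEMk_comp, Subobject.ofLEMk_comp]
  have hl : (v.comp s).Le (w.comp M) := FunRel.hom_eq_iff.1 h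
  obtain ⟨t, ht⟩ := v.total_nonempty z.2
  obtain ⟨x, hx⟩ := ex_ne (hl.nonempty (z.1, y)
    (Sig.ex_nonempty (and_ne ht (and_ne hy hy))))
  exact ⟨x, (ne_of_and hx).2⟩

/-- A subobject containing all points is `¬¬`-dense: it meets every subobject that has a point. -/
theorem isDoubleNegDense_of_rel_nonempty {M : FunRel X Y} [Mono M.hom]
    (hM : ∀ y, (Y.eq y y).act.Nonempty → ∃ x, (M.rel x y).act.Nonempty) :
    IsDoubleNegDense M.hom := by
  have hn : IsBot (Subobject.mk (FunRel.ofEmpty HT.isEmpty_empty Y).hom) :=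
    (isBot_mk_iff_isEmpty_pt _).2 HT.isEmpty_empty
  -- the pseudocomplement of `M` is the empty subobject, and that of the empty subobject is `⊤`
  refine ⟨_, fun d => ⟨fun hd c hc _ => hn.mono (hc.trans hd), fun hd => ?_⟩,
    fun d => ⟨fun _ c _ hc => hn.mono hc, fun _ => le_top⟩⟩
  -- a point `z` of `d` and a point `x` of `M` over the same `y` span a one-point object below both
  refine (isBot_iff_isEmpty_pt d).2 ⟨fun z => ?_⟩ _
  obtain ⟨D, hD⟩ := exists_rel d.arrow
  obtain ⟨y, hy⟩ := D.total_nonempty z.2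
  obtain ⟨x, hx⟩ := hM y (D.right_nonempty hy)
  have h := Entails.refl fun _ : PUnit.{u + 1} => (D.rel z.1 y).and (M.rel x y)
  let s := HT.point _ z.1 (D.left h.left)
  let t := HT.point _ x (M.left h.right)
  have hst : t.hom ≫ M.hom = s.hom ≫ d.arrow := by
    rw [← hD]
    exact FunRel.ofFun_comp_eq (Entails.ex_mk (fun _ => y) (h.right.and h.left))
  have := HT.mono_of_single (s.hom ≫ d.arrow)
  exact HT.not_isEmpty_single (and_ne hy hx) ((isBot_mk_iff_isEmpty_pt (s.hom ≫ d.arrow)).1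
    (hd _ (Subobject.mk_le_of_comm s.hom rfl) (Subobject.mk_le_mk_of_comm t.hom hst)))

/-! ### Separated objects -/

/-- The functional relation representing the unit `η`. -/
abbrev HT.etaRel (X : HT P) : FunRel X (nabla P X.Gamma) := X.transposeRel fun c => c

theorem HT.eq_nonempty_of_etaRel {x x' : X.carrier} {c : X.Gamma}
    (h : (X.etaRel.rel x c).act.Nonempty) (h' : (X.etaRel.rel x' c).act.Nonempty) :
    (X.eq x x').act.Nonempty := by
  obtain ⟨_, ⟨hx, e⟩, -⟩ := h
  obtain ⟨_, ⟨hx', e'⟩, -⟩ := h'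
  exact Quotient.exact (e.trans e'.symm)

theorem HT.exists_etaRel_nonempty (c : X.Gamma) : ∃ x, (X.etaRel.rel x c).act.Nonempty := by
  induction c using Quotient.inductionOn with | _ x => ?_
  exact ⟨x.1, x.2.imp fun _ hn => ⟨⟨x.2, rfl⟩, hn⟩⟩

/-- On the pairs of elements of `X` identified by `η`, the two projections agree on the subobject
where the components are equal. It contains all points, so it is `¬¬`-dense. -/
theorem mono_eta_of_isDoubleNegSeparated (hX : IsDoubleNegSeparated X) : Mono X.eta := by
  refine X.etaRel.mono_of_kernel_le ?_
  let K := X.etaRel.kernel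
  let K' : X.carrier × X.carrier → Sig P := fun p => (K p).and (X.eq p.1 p.2)
  have h := Entails.refl fun p : (X.carrier × X.carrier) × (X.carrier × X.carrier) =>
    ((K' p.1).and (K' p.2)).and ((X.eq p.1.1 p.2.1).and (X.eq p.1.2 p.2.2))
  let M : FunRel (X.pairs K') (X.pairs K) :=
    .ofFun (fun p => p) ((h.left.left.left.and h.left.right.left).and h.right)
  have hM : Mono M.hom := by
    refine M.mono_of_kernel_le ((Entails.refl M.kernel).ex_cases ?_)
    have h := (Entails.refl fun q : ((X.carrier × X.carrier) × (X.carrier × X.carrier)) ×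
        (X.carrier × X.carrier) =>
      ((M.rel q.1.1 q.2).and (M.rel q.1.2 q.2)).and (M.kernel q.1)).left
    have e := HT.trans' (X.pairs K) h.left.right ((X.pairs K).symm' h.right.right)
    exact (h.left.left.left.left.and h.right.left.left.left).and e.right
  refine HT.entails_eq_of_pairs X.etaRel.kernel_strict
    (hX _ _ M.hom (isDoubleNegDense_of_rel_nonempty fun p hp => ⟨p, ?_⟩) _ _
      (FunRel.ofFun_comp_eq ?_))
  · obtain ⟨c, hc⟩ := ex_ne (ne_of_and (ne_of_and hp).1).1
    have hK' := and_ne (ne_of_and (ne_of_and hp).1).1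
      (HT.eq_nonempty_of_etaRel (ne_of_and hc).1 (ne_of_and hc).2)
    exact and_ne (and_ne (and_ne hK' hK') (ne_of_and hp).2) hp
  · have h := Entails.refl fun p : X.carrier × X.carrier => (X.pairs K').eq p p
    have hp : Entails _ fun p : X.carrier × X.carrier => (X.pairs K).eq p p :=
      (h.left.left.left.and h.left.left.left).and h.right
    exact Entails.ex_mk (fun p => p.2) ((hp.and h.left.left.right).and (hp.and h.right.right))

/-- Two morphisms to a Herbrand assembly are equal as soon as they agree on points: once `a = a'`
is known, a realizer of `⟦a = a⟧` is all that `⟦a = a'⟧` requires. -/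
theorem HAsm.hom_ext (A : HAsm P) {F G : FunRel X A.toHT}
    (h : ∀ x a a', (F.rel x a).act.Nonempty → (G.rel x a').act.Nonempty → a = a') :
    F.hom = G.hom := by
  refine FunRel.hom_eq_iff.2 (?_ : Entails _ _)
  refine (G.total' (F.left (Entails.refl fun p : X.carrier × A.carrier =>
    F.rel p.1 p.2))).ex_cases ?_
  have h₁ := Entails.refl fun q : (X.carrier × A.carrier) × A.carrier =>
    (G.rel q.1.1 q.2).and (F.rel q.1.1 q.1.2)
  have h₂ : Entails _ fun q : (X.carrier × A.carrier) × A.carrier => A.sig q.2 :=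
    (G.right h₁.left).trans (.of_le (fun _ => subset_rfl) fun _ _ hn => And.right hn)
  exact G.ext' h₁.left (G.left h₁.left) (h₂.restrict fun q hq =>
    (h _ _ _ (h₁.right.nonempty q hq) (h₁.left.nonempty q hq)).symm)

theorem HAsm.isDoubleNegSeparated (A : HAsm P) : IsDoubleNegSeparated A.toHT := by
  intro X Y m _ hm f g h
  obtain ⟨M, rfl⟩ := exists_rel m
  obtain ⟨F, rfl⟩ := exists_rel f
  obtain ⟨G, rfl⟩ := exists_rel g
  have hl : (M.comp F).Le (M.comp G) := FunRel.hom_eq_iff.1 h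
  refine A.hom_ext fun y a a' ha ha' => ?_
  obtain ⟨x, hx⟩ := hm.exists_rel_nonempty (F.left_nonempty ha)
  obtain ⟨y', hy'⟩ := ex_ne (hl.nonempty (x, a) (Sig.ex_nonempty (and_ne hx ha)))
  obtain ⟨hxy', hy'a⟩ := ne_of_and hy'
  have e : (Y.eq y' y).act.Nonempty := M.single.nonempty (x, y', y) (and_ne hxy' hx)
  have hya := G.extensional.nonempty ((y', y), (a, a))
    (and_ne hy'a (and_ne e (G.right_nonempty hy'a)))
  obtain ⟨_, e', -⟩ := G.single.nonempty (y, a, a') (and_ne hya ha')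
  exact e'

theorem IsDoubleNegSeparated.of_iso {C : Type*} [Category C] {X Y : C}
    (hY : IsDoubleNegSeparated Y) (e : X ≅ Y) : IsDoubleNegSeparated X := by
  intro A B m _ hm f g h
  rw [← cancel_mono e.hom]
  refine hY A B m hm _ _ ?_
  rw [← Category.assoc, h, Category.assoc]

/-- The image of `η`: the Herbrand assembly on `ΓX` in which a class `c` is realized by the
realizers of `∃ x, x ∈ c`. Their potential realizers do not depend on `c`. -/
def HT.etaImage (X : HT P) : HAsm P where
  carrier := X.Gamma
  pot := ⋃ x, bang (X.eq x x).pot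
  act c := (Sig.ex fun x => X.etaRel.rel x c).act
  act_sub c := (Sig.ex fun x => X.etaRel.rel x c).act_sub
  act_up c := (Sig.ex fun x => X.etaRel.rel x c).up
  act_nonempty c := (HT.exists_etaRel_nonempty c).elim fun _ h => Sig.ex_nonempty h

theorem HT.eq_of_etaRel {x : X.carrier} {c c' : X.Gamma} (h : (X.etaRel.rel x c).act.Nonempty)
    (h' : (X.etaRel.rel x c').act.Nonempty) : c = c' := by
  obtain ⟨_, ⟨_, e⟩, -⟩ := h
  obtain ⟨_, ⟨_, e'⟩, -⟩ := h'
  exact e.symm.trans e'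

/-- `η` as a functional relation from `X` to its image. -/
def HT.toEtaImage (X : HT P) : FunRel X X.etaImage.toHT where
  rel := X.etaRel.rel
  strict := by
    have h := Entails.refl fun p : X.carrier × X.etaImage.carrier => X.etaRel.rel p.1 p.2
    have h₁ : Entails _ fun p : X.carrier × X.etaImage.carrier => X.etaImage.sig p.2 :=
      h.trans (Entails.single (ψ := fun (p : X.carrier × X.etaImage.carrier) x =>
        X.etaRel.rel x p.2) (fun p _ hn => ⟨p.1, hn⟩) fun p _ hn => ⟨p.1, hn⟩)
    exact (X.etaRel.left h).and (h₁.restrict fun _ _ => rfl)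
  extensional := by
    have h := Entails.refl fun p : (X.carrier × X.carrier) × (X.etaImage.carrier ×
        X.etaImage.carrier) => (X.etaRel.rel p.1.1 p.2.1).and
      ((X.eq p.1.1 p.1.2).and (X.etaImage.toHT.eq p.2.1 p.2.2))
    refine X.etaRel.ext' h.left h.right.left (h.right.right.trans (.const ?_))
    rintro _ ⟨_, e, -⟩
    exact nil_mem_nabla e
  single := by
    have h := (Entails.refl fun p : X.carrier × X.etaImage.carrier × X.etaImage.carrier =>
      (X.etaRel.rel p.1 p.2.1).and (X.etaRel.rel p.1 p.2.2)).left
    have h₁ : Entails _ fun p : X.carrier × X.etaImage.carrier × X.etaImage.carrier =>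
        X.etaImage.sig p.2.1 :=
      h.trans (Entails.single (ψ := fun (p : X.carrier × X.etaImage.carrier × X.etaImage.carrier) x =>
        X.etaRel.rel x p.2.1) (fun p _ hn => ⟨p.1, hn⟩) fun p _ hn => ⟨p.1, hn⟩)
    exact h₁.restrict fun p hp => HT.eq_of_etaRel (ne_of_and hp).1 (ne_of_and hp).2
  total := X.etaRel.total

theorem HT.toEtaImage_surjective (X : HT P) : Entails (fun c => X.etaImage.toHT.eq c c)
    fun c => Sig.ex fun x => X.toEtaImage.rel x c :=
  .of_le (fun _ => subset_rfl) fun _ _ hn => And.right hn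

/-- `η` and its corestriction to the image are given by the same predicate, so the latter is
internally injective when `η` is a monomorphism. Being surjective as well, it is invertible. -/
theorem nonempty_iso_etaImage [h : Mono X.eta] : Nonempty (X ≅ X.etaImage.toHT) :=
  ⟨X.toEtaImage.isoOfBijective (X.etaRel.kernel_le_of_mono (h := h)) X.toEtaImage_surjective⟩

end Herbrand

theorem mainTheorem3 {P : Type u} [PCA P] [Nontrivial P] (X : Herbrand.HT P) :
    List.TFAE [
      Mono X.eta,
      Herbrand.IsDoubleNegSeparated X,
      ∃ A : Herbrand.HAsm P, Nonempty (X ≅ A.toHT)] := by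
  tfae_have 1 → 3 := fun _ => ⟨X.etaImage, Herbrand.nonempty_iso_etaImage⟩
  tfae_have 3 → 2 := fun ⟨A, ⟨e⟩⟩ => A.isDoubleNegSeparated.of_iso e
  tfae_have 2 → 1 := Herbrand.mono_eta_of_isDoubleNegSeparated
  tfae_finish
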